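/- Let $\Lambda$ be a finite set of lattice sites with $|\Lambda|$ even, let $(t_{x,y})_{x,y\in\Lambda}$ be real hopping amplitudes with $t_{x,y}=t_{y,x}$, and let $U>0$. Let $c_{x,\sigma}$, $c^\dagger_{x,\sigma}$ ($x\in\Lambda$, $\sigma=\uparrow,\downarrow$) be the annihilation and creation operators of spin-$\tfrac12$ electrons on $\Lambda$, acting on the $4^{|\Lambda|}$-dimensional Fock space, and let $n_{x,\sigma}=c^\dagger_{x,\sigma}c_{x,\sigma}$. The Hubbard Hamiltonian is $$H=\sum_{x,y\in\Lambda}\ \sum_{\sigma=\uparrow,\downarrow}t_{x,y}\,c^\dagger_{x,\sigma}c_{y,\sigma}+U\sum_{x\in\Lambda}n_{x,\uparrow}n_{x,\downarrow}.$$ Let $\hat N_{\rm e}=\sum_{x\in\Lambda}(n_{x,\uparrow}+n_{x,\downarrow})$, and let $(\hat{\mathbf S}_{\rm tot})^2=\sum_{\alpha=1}^3\bigl(\hat S^{(\alpha)}_{\rm tot}\bigr)^2$ with $\hat S^{(\alpha)}_{\rm tot}=\frac12\sum_{x\in\Lambda}\sum_{\sigma,\tau}c^\dagger_{x,\sigma}(p^{(\alpha)})_{\sigma,\tau}c_{x,\tau}$,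 where $p^{(1)},p^{(2)},p^{(3)}$ are the Pauli matrices. Assume that the model is bipartite, i.e. $\Lambda$ is a disjoint union $\Lambda=A\cup B$ with $t_{x,y}=0$ whenever $x,y\in A$ or $x,y\in B$. Assume also that $\Lambda$ is connected through nonvanishing hopping, i.e. for all $x,y\in\Lambda$ there are $x_0=x,x_1,\dots,x_N=y$ in $\Lambda$ with $t_{x_i,x_{i+1}}\neq0$ for $0\le i<N$. At half filling (electron number $N_{\rm e}=|\Lambda|$), let $E_{\min}(S)$ be the minimum of $\langle\Phi,H\Phi\rangle$ over all normalized states $\Phi$ with $\hat N_{\rm e}\Phi=|\Lambda|\,\Phi$ and $(\hat{\mathbf S}_{\rm tot})^2\Phi=S(S+1)\Phi$. Then, for every integer $S$ with $$\frac{\bigl||A|-|B|\bigr|}{2}\le S\le\frac{|\Lambda|}{2}-1,$$ such states exist for both $S$ and $S+1$, both minima are attained, and $$E_{\min}(S)<E_{\min}(S+1).$$ -/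

import Mathlib

open scoped Kronecker

noncomputable section

namespace Hubbard

set_option linter.unusedSectionVars false
set_option linter.unusedSimpArgs false

variable {Λ : Type*} [Fintype Λ] [LinearOrder Λ]

/-! Fermions of a single spin species. The orthonormal basis of the Fock space of one species
on the finite set of sites `Λ` is indexed by the set `X : Finset Λ` of occupied sites; the basis
vector of `X` is the product of the creation operators of the sites in `X`, in increasing order,
applied to the vacuum. The linear order only fixes the signs of the basis vectors. -/

/-- The sign `(-1) ^ #{z ∈ X | z < x}`. -/
def jwSign (x : Λ) (X : Finset Λ) : ℂ := (-1) ^ (X.filter (· < x)).card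

/-- Annihilation operator at `x` for one species: it maps the basis vector of `insert x X`
(where `x ∉ X`) to `jwSign x X` times the basis vector of `X`, and the basis vectors of the sets
that do not contain `x` to `0`. -/
def ann (x : Λ) : Matrix (Finset Λ) (Finset Λ) ℂ :=
  Matrix.of fun X Y => if x ∉ X ∧ Y = insert x X then jwSign x X else 0

/-- The fermion parity `(-1) ^ #X` of one species. -/
def parity : Matrix (Finset Λ) (Finset Λ) ℂ :=
  Matrix.diagonal fun X => (-1) ^ X.card

/-! The electrons: `0 : Fin 2` is spin up and `1 : Fin 2` is spin down. -/

/-- Basis configurations `(X, Y)`: `X` is the set of sites carrying an up electron and `Y` the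
set of sites carrying a down electron. -/
abbrev Config (Λ : Type*) : Type _ := Finset Λ × Finset Λ

/-- Linear operators on the `4 ^ |Λ|`-dimensional Fock space, as matrices in the orthonormal
basis indexed by `Config Λ`. -/
abbrev Op (Λ : Type*) : Type _ := Matrix (Config Λ) (Config Λ) ℂ

/-- State vectors, by their coordinates in the orthonormal basis indexed by `Config Λ`; the
inner product of `Φ` and `Ψ` is `star Φ ⬝ᵥ Ψ`. -/
abbrev State (Λ : Type*) : Type _ := Config Λ → ℂ

/-- The annihilation operator of an electron with spin `σ` at the site `x`. The parity factor
makes operators of different spins anticommute. -/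
def c (x : Λ) (σ : Fin 2) : Op Λ :=
  if σ = 0 then ann x ⊗ₖ (1 : Matrix (Finset Λ) (Finset Λ) ℂ) else parity ⊗ₖ ann x

/-- The creation operator of an electron with spin `σ` at the site `x`. -/
def cDag (x : Λ) (σ : Fin 2) : Op Λ := (c x σ).conjTranspose

/-- The state without electrons. -/
def vacuum : State Λ := Pi.single (∅, ∅) 1

/-- The number operator of electrons with spin `σ` at the site `x`. -/
def num (x : Λ) (σ : Fin 2) : Op Λ := cDag x σ * c x σ

/-- The total number operator. -/
def totalNum : Op Λ := ∑ x : Λ, (num x 0 + num x 1)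

/-- The hopping Hamiltonian. -/
def hopping (t : Λ → Λ → ℝ) : Op Λ :=
  ∑ x : Λ, ∑ y : Λ, ∑ σ : Fin 2, (t x y : ℂ) • (cDag x σ * c y σ)

/-- The on-site interaction Hamiltonian. -/
def interaction (U : Λ → ℝ) : Op Λ :=
  ∑ x : Λ, (U x : ℂ) • (num x 0 * num x 1)

/-- The Hubbard Hamiltonian. -/
def hamiltonian (t : Λ → Λ → ℝ) (U : Λ → ℝ) : Op Λ := hopping t + interaction U

/-- The three Pauli matrices. -/
def pauli : Fin 3 → Matrix (Fin 2) (Fin 2) ℂ :=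
  ![!![0, 1; 1, 0], !![0, -Complex.I; Complex.I, 0], !![1, 0; 0, -1]]

/-- The spin operator at the site `x`, component `α`. -/
def spin (α : Fin 3) (x : Λ) : Op Λ :=
  (1 / 2 : ℂ) • ∑ σ : Fin 2, ∑ τ : Fin 2, pauli α σ τ • (cDag x σ * c x τ)

/-- The total spin operator, component `α`. -/
def totalSpin (α : Fin 3) : Op Λ := ∑ x : Λ, spin α x

/-- The square of the total spin. -/
def totalSpinSq : Op Λ := ∑ α : Fin 3, totalSpin α * totalSpin α

/-- The energies `⟨Φ, H Φ⟩` of the normalized states `Φ` with electron number `Ne` and total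
spin `S`. -/
def energies (t : Λ → Λ → ℝ) (U : Λ → ℝ) (Ne : ℕ) (S : ℝ) : Set ℝ :=
  {E | ∃ Φ : State Λ, star Φ ⬝ᵥ Φ = 1 ∧
    Matrix.mulVec totalNum Φ = (Ne : ℂ) • Φ ∧
    Matrix.mulVec totalSpinSq Φ = ((S * (S + 1) : ℝ) : ℂ) • Φ ∧
    E = (star Φ ⬝ᵥ Matrix.mulVec (hamiltonian t U) Φ).re}

/-- The lowest energy `E_min(S)` among the states with electron number `Ne` and total
spin `S`. -/
def Emin (t : Λ → Λ → ℝ) (U : Λ → ℝ) (Ne : ℕ) (S : ℝ) : ℝ := sInf (energies t U Ne S)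

/-- `Λ` is the disjoint union of `A` and `B`, and all hopping within `A` and within `B`
vanishes. -/
def IsBipartite (t : Λ → Λ → ℝ) (A B : Finset Λ) : Prop :=
  Disjoint A B ∧ A ∪ B = Finset.univ ∧
    (∀ x ∈ A, ∀ y ∈ A, t x y = 0) ∧ (∀ x ∈ B, ∀ y ∈ B, t x y = 0)

/-- Any two sites are joined by a chain of nonvanishing hopping amplitudes. -/
def IsConnected (t : Λ → Λ → ℝ) : Prop :=
  ∀ x y : Λ, Relation.ReflTransGen (fun a b => t a b ≠ 0) x y

/-! The canonical anticommutation relations. -/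

theorem card_config : Fintype.card (Config Λ) = 4 ^ Fintype.card Λ := by
  rw [Fintype.card_prod, Fintype.card_finset, ← mul_pow]; norm_num

lemma jwSign_mul_self (x : Λ) (X : Finset Λ) : jwSign x X * jwSign x X = 1 := by
  unfold jwSign
  rw [← pow_add, ← two_mul, pow_mul]; simp

lemma jwSign_insert (x y : Λ) (X : Finset Λ) (hx : x ∉ X) :
    jwSign y (insert x X) = if x < y then -jwSign y X else jwSign y X := by
  unfold jwSign
  rw [Finset.filter_insert]
  split_ifs with h
  · rw [Finset.card_insert_of_notMem (by simp [hx]), pow_succ]; ring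
  · rfl

lemma ann_apply (x : Λ) (X Y : Finset Λ) :
    ann x X Y = if x ∉ X ∧ Y = insert x X then jwSign x X else 0 := rfl

lemma star_jwSign (x : Λ) (X : Finset Λ) : star (jwSign x X) = jwSign x X := by
  simp [jwSign]

lemma ann_mul_apply (x : Λ) (M : Matrix (Finset Λ) (Finset Λ) ℂ) (X Z : Finset Λ) :
    (ann x * M) X Z = if x ∉ X then jwSign x X * M (insert x X) Z else 0 := by
  rw [Matrix.mul_apply, Finset.sum_eq_single (insert x X)]
  · by_cases h : x ∈ X <;> simp [ann_apply, h]
  · intro Y _ hY; simp [ann_apply, hY]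
  · simp

lemma annT_mul_apply (x : Λ) (M : Matrix (Finset Λ) (Finset Λ) ℂ) (X Z : Finset Λ) :
    ((ann x).conjTranspose * M) X Z
      = if x ∈ X then jwSign x (X.erase x) * M (X.erase x) Z else 0 := by
  rw [Matrix.mul_apply, Finset.sum_eq_single (X.erase x)]
  · by_cases h : x ∈ X
    · simp [Matrix.conjTranspose_apply, ann_apply, h, Finset.insert_erase h, star_jwSign,
        -RCLike.star_def]
    · have : X ≠ insert x X := fun h' => h (h' ▸ Finset.mem_insert_self x X)
      simp [Matrix.conjTranspose_apply, ann_apply, h, this]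
  · intro Y _ hY
    rw [Matrix.conjTranspose_apply, ann_apply, if_neg]
    · simp
    · rintro ⟨h1, rfl⟩
      exact hY (by rw [Finset.erase_insert h1])
  · simp

lemma ann_anticomm (x y : Λ) : ann x * ann y + ann y * ann x = 0 := by
  ext X Z
  rw [Matrix.add_apply, ann_mul_apply, ann_mul_apply, ann_apply, ann_apply]
  by_cases hx : x ∈ X
  · simp [hx]
  by_cases hy : y ∈ X
  · simp [hy]
  have h1 := jwSign_insert x y X hx
  have h2 := jwSign_insert y x X hy
  rw [Finset.insert_comm y x]
  by_cases hxy : x = y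
  · subst hxy; simp
  by_cases hZ : Z = insert y (insert x X)
  · rcases lt_or_gt_of_ne hxy with h | h
    · rw [if_pos h] at h1
      rw [if_neg h.not_gt] at h2
      simp [hx, hy, h1, h2, hxy, Ne.symm hxy, hZ, Finset.insert_comm x y]; ring
    · rw [if_neg h.not_gt] at h1
      rw [if_pos h] at h2
      simp [hx, hy, h1, h2, hxy, Ne.symm hxy, hZ, Finset.insert_comm x y]; ring
  · simp [hZ, Finset.insert_comm x y]

lemma annT_anticomm (x y : Λ) :
    (ann x).conjTranspose * ann y + ann y * (ann x).conjTranspose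
      = if x = y then 1 else 0 := by
  ext X Z
  rw [Matrix.add_apply, annT_mul_apply, ann_mul_apply, Matrix.conjTranspose_apply, ann_apply,
    ann_apply]
  by_cases hxy : x = y
  · subst hxy
    by_cases hx : x ∈ X
    · simp only [hx, Finset.insert_erase hx]
      by_cases hZ : Z = X
      · subst hZ; simp [jwSign_mul_self]
      · simp [hZ, Ne.symm hZ]
    · by_cases hZ : Z = X
      · subst hZ; simp [hx, star_jwSign, jwSign_mul_self, -RCLike.star_def]
      · have h1 : ¬ (x ∉ Z ∧ insert x X = insert x Z) := by
          rintro ⟨h1, h2⟩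
          apply hZ
          rw [← Finset.erase_insert h1, ← h2, Finset.erase_insert hx]
        simp [hx, h1, Ne.symm hZ]
  · rw [if_neg hxy]
    by_cases hx : x ∈ X
    · by_cases hy : y ∈ X
      · simp [hy, Ne.symm hxy]
      · obtain ⟨W, hW, rfl⟩ : ∃ W, x ∉ W ∧ X = insert x W :=
          ⟨X.erase x, by simp, (Finset.insert_erase hx).symm⟩
        have hyW : y ∉ W := fun h => hy (Finset.mem_insert_of_mem h)
        have hxy' : x ∉ insert y W := by simp [hxy, hW]
        have key : (x ∉ Z ∧ insert y (insert x W) = insert x Z) ↔ Z = insert y W := by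
          constructor
          · rintro ⟨h1, h2⟩
            rw [← Finset.erase_insert h1, ← h2, Finset.insert_comm, Finset.erase_insert hxy']
          · rintro rfl
            exact ⟨hxy', Finset.insert_comm _ _ _⟩
        simp only [key, Finset.erase_insert hW, hyW, hy, Finset.mem_insert_self]
        by_cases hZ : Z = insert y W
        · subst hZ
          simp only [jwSign_insert _ _ _ hW, jwSign_insert _ _ _ hyW]
          rcases lt_or_gt_of_ne hxy with h | h
          · simp [h, not_lt.mpr h.le, star_jwSign, -RCLike.star_def]; ring
          · simp [h, not_lt.mpr h.le, star_jwSign, -RCLike.star_def]; ring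
        · simp [hZ]
    · have h1 : ¬ (x ∉ Z ∧ insert y X = insert x Z) := by
        rintro ⟨_, h2⟩
        have : x ∈ insert y X := h2 ▸ Finset.mem_insert_self x Z
        simp [hxy, hx] at this
      simp [hx, h1]

lemma parity_mul_ann (x : Λ) : parity * ann x + ann x * parity = 0 := by
  ext X Z
  rw [Matrix.add_apply, parity, Matrix.diagonal_mul, Matrix.mul_diagonal, ann_apply]
  split_ifs with h
  · obtain ⟨h1, rfl⟩ := h
    rw [Finset.card_insert_of_notMem h1, pow_succ]; simp; ring
  · simp

lemma parity_conjTranspose :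
    (parity : Matrix (Finset Λ) (Finset Λ) ℂ).conjTranspose = parity := by
  rw [parity, Matrix.diagonal_conjTranspose]
  congr 1; ext X; simp

lemma parity_mul_parity : (parity : Matrix (Finset Λ) (Finset Λ) ℂ) * parity = 1 := by
  rw [parity, Matrix.diagonal_mul_diagonal, ← Matrix.diagonal_one]
  congr 1; ext X; rw [← pow_add, ← two_mul, pow_mul]; simp

lemma annT_mul_parity (x : Λ) :
    (ann x).conjTranspose * parity + parity * (ann x).conjTranspose = 0 := by
  have := congrArg Matrix.conjTranspose (parity_mul_ann x)
  simpa [Matrix.conjTranspose_add, Matrix.conjTranspose_mul, parity_conjTranspose] using this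

theorem c_anticomm (x y : Λ) (σ τ : Fin 2) : c x σ * c y τ + c y τ * c x σ = 0 := by
  fin_cases σ <;> fin_cases τ <;>
    simp only [c, Fin.zero_eta, Fin.mk_one, if_true, one_ne_zero, if_false,
      ← Matrix.mul_kronecker_mul, mul_one, one_mul, ← Matrix.add_kronecker,
      ← Matrix.kronecker_add, ann_anticomm, parity_mul_ann, add_comm (ann _ * parity),
      Matrix.zero_kronecker, Matrix.kronecker_zero]

theorem cDag_anticomm (x y : Λ) (σ τ : Fin 2) :
    cDag x σ * cDag y τ + cDag y τ * cDag x σ = 0 := by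
  have := congrArg Matrix.conjTranspose (c_anticomm y x τ σ)
  simpa [cDag, Matrix.conjTranspose_add, Matrix.conjTranspose_mul] using this

theorem cDag_c_anticomm (x y : Λ) (σ τ : Fin 2) :
    cDag x σ * c y τ + c y τ * cDag x σ = if x = y ∧ σ = τ then 1 else 0 := by
  fin_cases σ <;> fin_cases τ <;>
    simp only [c, cDag, Fin.zero_eta, Fin.mk_one, if_true, one_ne_zero, zero_ne_one, if_false,
      Matrix.conjTranspose_kronecker, Matrix.conjTranspose_one, parity_conjTranspose,
      ← Matrix.mul_kronecker_mul, mul_one, one_mul, ← Matrix.add_kronecker,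
      ← Matrix.kronecker_add, annT_anticomm, annT_mul_parity, parity_mul_ann, parity_mul_parity,
      Matrix.zero_kronecker, Matrix.kronecker_zero, and_true, and_false]
  · split_ifs <;> simp
  · split_ifs <;> simp

theorem c_vacuum (x : Λ) (σ : Fin 2) : Matrix.mulVec (c x σ) vacuum = 0 := by
  ext ⟨X, Y⟩
  have h : ∀ Z : Finset Λ, ann x Z ∅ = 0 := fun Z => by
    simp [ann_apply, (Finset.insert_ne_empty x Z).symm]
  fin_cases σ <;> simp [vacuum, c, h]

end Hubbard

end

/-!
Write a state as a matrix `F`, with `F X Y` the amplitude for up electrons in `X` and down electrons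
in `Y`. The particle-hole transformation `V` of the down electrons, with signs alternating between
the two sublattices (`phole`), turns `F = W Vᵀ` into a matrix `W` indexed by up electrons and down
holes. At half filling and third spin component `M`, both species consist of `n = |Λ| / 2 + M`
particles, and the Hamiltonian becomes the attractive one
`W ↦ T W + W T - U ∑ x, n_x W n_x + U n W` (`hamiltonian_mulVec_phState`).

* **Reflection positivity** (Lieb). Replacing a Hermitian `W = P - Q` by `P + Q` does not raise the
  energy (`trace_mul_reflOp_abs_le`), so that the positive and negative parts of a ground state are
  ground states. The kernel of a positive semidefinite ground state is invariant under `T` and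
  all `n_x` (`PosSemidef.ker_invariant`), which act irreducibly on the `n` particle states because
  the lattice is connected (`single_mem_of_hop_occ_invariant`). Hence one of `P` and `Q` vanishes,
  and a ground state orthogonal to a diagonal matrix with positive entries is zero
  (`eq_zero_of_ground_of_trace_eq_zero`).
* **Reference state.** For `n` at least the sizes of `A` and `B`, that is for `M` at least
  `||A| - |B|| / 2`, the diagonal matrix with entries `|X ∩ A|! |X \ A|!` is annihilated by the spin
  raising operator (`spinHop_up_down_mulVec_refState`). So it has total spin `M`.
* **Ground states of a sector.** If `Φ` is a ground state of the sector with third spin component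
  `M`, so is `S⁻ S⁺ Φ` unless it is zero. It is orthogonal to the reference state, and so it is
  zero: `Φ` has total spin `M` (`spinHop_mulVec_eq_zero_of_sector_ground`).

For `M = S` this shows that `E_min(S)` is at most the lowest energy of the sector. A state of lowest
energy with spin `S + 1` is an eigenstate, and its multiplet contains an eigenstate of the same
energy with third component `S` (`exists_lowered_eigenstate`). This one has the wrong total spin
for a ground state of the sector, so that its energy `E_min(S + 1)` is strictly higher.
-/

namespace Hubbard

set_option linter.unusedSectionVars false

open Matrix
open scoped ComplexOrder

/-! ### Variational principle for Hermitian matrices -/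

section Variational

variable {ι : Type*} [Fintype ι]

lemma star_dotProduct_self_re_pos {v : ι → ℂ} (hv : v ≠ 0) : 0 < (star v ⬝ᵥ v).re := by
  have h := (dotProduct_star_self_pos_iff (v := v)).2 hv
  exact (Complex.lt_def.1 h).1

lemma star_dotProduct_self_re_nonneg (v : ι → ℂ) : 0 ≤ (star v ⬝ᵥ v).re := by
  by_cases hv : v = 0
  · simp [hv]
  · exact (star_dotProduct_self_re_pos hv).le

lemma star_dotProduct_self_eq_ofReal (v : ι → ℂ) :
    star v ⬝ᵥ v = (((star v ⬝ᵥ v).re : ℝ) : ℂ) := by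
  apply Complex.ext
  · simp
  · simpa using (Complex.le_def.1 (dotProduct_star_self_nonneg v)).2.symm

lemma exists_smul_unit {v : ι → ℂ} (hv : v ≠ 0) :
    ∃ a : ℝ, a * a * (star v ⬝ᵥ v).re = 1 ∧ star ((a : ℂ) • v) ⬝ᵥ ((a : ℂ) • v) = 1 := by
  have hpos := star_dotProduct_self_re_pos hv
  have hs := Real.sqrt_pos.2 hpos
  have hss := Real.mul_self_sqrt hpos.le
  have h : 1 / Real.sqrt (star v ⬝ᵥ v).re * (1 / Real.sqrt (star v ⬝ᵥ v).re)
      * (star v ⬝ᵥ v).re = 1 := by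
    field_simp
    nlinarith
  refine ⟨1 / Real.sqrt (star v ⬝ᵥ v).re, h, ?_⟩
  rw [star_smul, smul_dotProduct, dotProduct_smul, star_dotProduct_self_eq_ofReal v, smul_smul]
  simp only [RCLike.star_def, Complex.conj_ofReal, smul_eq_mul]
  rw [← Complex.ofReal_mul, ← Complex.ofReal_mul, Complex.ofReal_re, h, Complex.ofReal_one]

lemma IsHermitian.star_dotProduct_mulVec {H : Matrix ι ι ℂ} (hH : H.IsHermitian)
    (v w : ι → ℂ) : star (H *ᵥ v) ⬝ᵥ w = star v ⬝ᵥ H *ᵥ w := by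
  rw [star_mulVec, hH.eq, dotProduct_mulVec]

/-- The energy of a Hermitian matrix attains its minimum over the unit vectors of a nonzero
subspace. -/
lemma exists_min_energy (H : Matrix ι ι ℂ) (K : Submodule ℂ (ι → ℂ))
    (hK : ∃ v ∈ K, v ≠ 0) :
    ∃ v ∈ K, star v ⬝ᵥ v = 1 ∧ ∀ w ∈ K, star w ⬝ᵥ w = 1 →
      (star v ⬝ᵥ H *ᵥ v).re ≤ (star w ⬝ᵥ H *ᵥ w).re := by
  let s : Set (ι → ℂ) := {v | v ∈ K ∧ star v ⬝ᵥ v = 1}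
  have hclosed : IsClosed s := by
    apply IsClosed.inter
    · exact Submodule.closed_of_finiteDimensional K
    · exact isClosed_eq (by unfold dotProduct; fun_prop) continuous_const
  have hbdd : Bornology.IsBounded s := by
    refine (Metric.isBounded_closedBall (x := (0 : ι → ℂ)) (r := 1)).subset ?_
    rintro v ⟨-, hv⟩
    rw [mem_closedBall_zero_iff, pi_norm_le_iff_of_nonneg zero_le_one]
    intro i
    have h1 : ∑ j, ‖v j‖ ^ 2 = 1 := by
      have h2 : star v ⬝ᵥ v = ((∑ j, ‖v j‖ ^ 2 : ℝ) : ℂ) := by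
        simp [dotProduct, Complex.conj_mul']
      rw [hv] at h2
      exact_mod_cast h2.symm
    have h3 : ‖v i‖ ^ 2 ≤ 1 := by
      rw [← h1]
      exact Finset.single_le_sum (f := fun j => ‖v j‖ ^ 2) (fun j _ => by positivity)
        (Finset.mem_univ i)
    exact (sq_le_one_iff₀ (norm_nonneg _)).1 h3
  have hne : s.Nonempty := by
    obtain ⟨v, hv, hv0⟩ := hK
    obtain ⟨a, -, ha⟩ := exists_smul_unit hv0
    exact ⟨_, K.smul_mem _ hv, ha⟩
  obtain ⟨v, hv, hmin⟩ := (Metric.isCompact_of_isClosed_isBounded hclosed hbdd).exists_isMinOn hne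
    (f := fun v => (star v ⬝ᵥ H *ᵥ v).re)
    (by apply Continuous.continuousOn; unfold dotProduct mulVec dotProduct; fun_prop)
  exact ⟨v, hv.1, hv.2, fun w hw hw1 => hmin ⟨hw, hw1⟩⟩

lemma mul_le_energy_of_unit {H : Matrix ι ι ℂ} {K : Submodule ℂ (ι → ℂ)} {E : ℝ}
    (hE : ∀ w ∈ K, star w ⬝ᵥ w = 1 → E ≤ (star w ⬝ᵥ H *ᵥ w).re) (v : ι → ℂ) (hv : v ∈ K) :
    E * (star v ⬝ᵥ v).re ≤ (star v ⬝ᵥ H *ᵥ v).re := by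
  by_cases hv0 : v = 0
  · simp [hv0]
  have hpos := star_dotProduct_self_re_pos hv0
  obtain ⟨a, ha, hunit⟩ := exists_smul_unit hv0
  have h := hE _ (K.smul_mem _ hv) hunit
  rw [star_smul, smul_dotProduct, mulVec_smul, dotProduct_smul, smul_smul] at h
  simp only [RCLike.star_def, Complex.conj_ofReal, smul_eq_mul] at h
  rw [← Complex.ofReal_mul, Complex.re_ofReal_mul] at h
  calc E * (star v ⬝ᵥ v).re ≤ (a * a * (star v ⬝ᵥ H *ᵥ v).re) * (star v ⬝ᵥ v).re := by gcongr
    _ = (a * a * (star v ⬝ᵥ v).re) * (star v ⬝ᵥ H *ᵥ v).re := by ring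
    _ = _ := by rw [ha, one_mul]

/-- A vector that attains the minimal energy of an invariant subspace is an eigenvector. -/
lemma mulVec_eq_smul_of_energy_le {H : Matrix ι ι ℂ} (hH : H.IsHermitian)
    {K : Submodule ℂ (ι → ℂ)} (hK : ∀ v ∈ K, H *ᵥ v ∈ K) {E : ℝ}
    (hE : ∀ w ∈ K, star w ⬝ᵥ w = 1 → E ≤ (star w ⬝ᵥ H *ᵥ w).re) {v : ι → ℂ} (hv : v ∈ K)
    (hvE : (star v ⬝ᵥ H *ᵥ v).re ≤ E * (star v ⬝ᵥ v).re) :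
    H *ᵥ v = (E : ℂ) • v := by
  set w := H *ᵥ v - (E : ℂ) • v with hw
  have hwK : w ∈ K := K.sub_mem (hK v hv) (K.smul_mem _ hv)
  by_contra hne
  have hw0 : w ≠ 0 := fun h => hne (sub_eq_zero.1 h)
  have hpos := star_dotProduct_self_re_pos hw0
  set a := (star w ⬝ᵥ w).re with ha
  set b := (star w ⬝ᵥ H *ᵥ w).re - E * a with hb
  -- The energy of `v + s w`, shifted by `E`, is at most `2 s a + s ^ 2 b`, which is negative for
  -- small negative `s`.
  have key : ∀ s : ℝ, 0 ≤ 2 * s * a + s ^ 2 * b := by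
    intro s
    have h := mul_le_energy_of_unit hE (v + (s : ℂ) • w) (K.add_mem hv (K.smul_mem _ hwK))
    have e1 : star v ⬝ᵥ H *ᵥ w = star (H *ᵥ v) ⬝ᵥ w :=
      (IsHermitian.star_dotProduct_mulVec hH v w).symm
    have e2 : H *ᵥ v = w + (E : ℂ) • v := by rw [hw]; abel
    simp only [mulVec_add, mulVec_smul, star_add, star_smul, add_dotProduct, dotProduct_add,
      smul_dotProduct, dotProduct_smul, e1, RCLike.star_def, Complex.conj_ofReal, smul_eq_mul,
      Complex.add_re, Complex.re_ofReal_mul] at h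
    rw [e2] at h hvE
    simp only [star_add, star_smul, add_dotProduct, dotProduct_add,
      smul_dotProduct, dotProduct_smul, RCLike.star_def, Complex.conj_ofReal, smul_eq_mul,
      Complex.add_re, Complex.re_ofReal_mul] at h hvE
    rw [← ha] at h
    nlinarith
  rcases le_or_gt b 0 with hb0 | hb0
  · have := key (-1); nlinarith
  · have := key (-(a / b))
    have h2 : a / b * b = a := div_mul_cancel₀ _ hb0.ne'
    have h3 : 0 < a / b := div_pos hpos hb0
    nlinarith

end Variational

/-! ### Reflection positivity -/

section Reflection

variable {ι κ : Type*} [Fintype ι] [DecidableEq ι] [Fintype κ]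

/-- A Hermitian matrix is the difference of two positive semidefinite matrices whose product
vanishes and which are multiples of it on both sides. -/
lemma IsHermitian.exists_pos_sub_neg {W : Matrix ι ι ℂ} (hW : W.IsHermitian) :
    ∃ P Q : Matrix ι ι ℂ, P.PosSemidef ∧ Q.PosSemidef ∧ W = P - Q ∧ P * Q = 0 ∧ Q * P = 0 ∧
      (∃ G, P = W * G ∧ P = G * W) ∧ (∃ G, Q = W * G ∧ Q = G * W) := by
  obtain ⟨e, u, huu, hsp⟩ : ∃ (e : ι → ℝ) (u : Matrix ι ι ℂ), star u * u = 1 ∧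
      W = u * diagonal (fun i => (e i : ℂ)) * star u := by
    refine ⟨hW.eigenvalues, hW.eigenvectorUnitary,
      Unitary.coe_star_mul_self hW.eigenvectorUnitary, ?_⟩
    have := hW.spectral_theorem
    rw [Unitary.conjStarAlgAut_apply] at this
    simpa [Function.comp_def] using this
  let f : (ι → ℂ) → Matrix ι ι ℂ := fun d => u * diagonal d * star u
  have hmul : ∀ d d', f d * f d' = f (fun i => d i * d' i) := by
    intro d d'
    calc f d * f d' = u * diagonal d * (star u * u) * diagonal d' * star u := by
          simp only [f, Matrix.mul_assoc]
      _ = _ := by rw [huu, Matrix.mul_one, Matrix.mul_assoc u, diagonal_mul_diagonal]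
  have hpsd : ∀ d : ι → ℝ, (∀ i, 0 ≤ d i) → (f fun i => (d i : ℂ)).PosSemidef := by
    intro d hd
    have h : (diagonal fun i => (d i : ℂ)).PosSemidef :=
      PosSemidef.diagonal fun i => by simpa using hd i
    exact h.mul_mul_conjTranspose_same u
  have hsp' : W = f fun i => (e i : ℂ) := hsp
  have hcongr : ∀ d d' : ι → ℂ, (∀ i, d i = d' i) → f d = f d' := fun d d' h => by rw [funext h]
  refine ⟨f fun i => ((max (e i) 0 : ℝ) : ℂ),
    f fun i => ((max (-e i) 0 : ℝ) : ℂ), hpsd _ fun i => le_max_right _ _,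
    hpsd _ fun i => le_max_right _ _, ?_, ?_, ?_,
    ⟨f fun i => if 0 ≤ e i then 1 else 0, ?_, ?_⟩,
    ⟨f fun i => if 0 ≤ e i then 0 else -1, ?_, ?_⟩⟩
  · conv_lhs => rw [hsp']
    simp only [f]
    rw [← Matrix.sub_mul, ← Matrix.mul_sub, diagonal_sub]
    refine hcongr _ _ fun i => ?_
    rcases le_total 0 (e i) with h | h
    · simp [max_eq_left h, max_eq_right (neg_nonpos.2 h)]
    · simp [max_eq_right h, max_eq_left (neg_nonneg.2 h)]
  · rw [hmul, show (0 : Matrix ι ι ℂ) = f fun _ => 0 by simp [f]]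
    refine hcongr _ _ fun i => ?_
    rcases le_total 0 (e i) with h | h
    · simp [max_eq_right (neg_nonpos.2 h)]
    · simp [max_eq_right h]
  · rw [hmul, show (0 : Matrix ι ι ℂ) = f fun _ => 0 by simp [f]]
    refine hcongr _ _ fun i => ?_
    rcases le_total 0 (e i) with h | h
    · simp [max_eq_right (neg_nonpos.2 h)]
    · simp [max_eq_right h]
  all_goals
    rw [hsp', hmul]
    refine hcongr _ _ fun i => ?_
    split_ifs with h
    · simp [h]
    · simp [(not_le.1 h).le]

/-- The operator `W ↦ T W + W T - u ∑ x, D x W (D x)` on matrices: the Hamiltonian of two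
identical species that hop by `T` and attract each other through the observables `D x`. -/
def reflOp (T : Matrix ι ι ℂ) (D : κ → Matrix ι ι ℂ) (u : ℝ) (W : Matrix ι ι ℂ) :
    Matrix ι ι ℂ :=
  T * W + W * T - (u : ℂ) • ∑ x, D x * W * D x

/-- All nonzero entries of `W` lie in rows and columns satisfying `p`. -/
def SupportedOn (p : ι → Prop) (W : Matrix ι ι ℂ) : Prop := ∀ i j, W i j ≠ 0 → p i ∧ p j

variable {T : Matrix ι ι ℂ} {D : κ → Matrix ι ι ℂ} {u : ℝ} {p : ι → Prop}

lemma reflOp_add (V W : Matrix ι ι ℂ) :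
    reflOp T D u (V + W) = reflOp T D u V + reflOp T D u W := by
  simp only [reflOp, Matrix.mul_add, Matrix.add_mul, Finset.sum_add_distrib, smul_add]
  abel

lemma reflOp_smul (a : ℂ) (W : Matrix ι ι ℂ) :
    reflOp T D u (a • W) = a • reflOp T D u W := by
  simp only [reflOp, Matrix.mul_smul, Matrix.smul_mul, ← Finset.smul_sum, smul_sub, smul_add,
    smul_comm (u : ℂ) a]

lemma reflOp_sub (V W : Matrix ι ι ℂ) :
    reflOp T D u (V - W) = reflOp T D u V - reflOp T D u W := by
  rw [sub_eq_add_neg, ← neg_one_smul ℂ W, reflOp_add, reflOp_smul, neg_one_smul, sub_eq_add_neg]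

lemma reflOp_conjTranspose (hT : T.IsHermitian) (hD : ∀ x, (D x).IsHermitian)
    (W : Matrix ι ι ℂ) : reflOp T D u Wᴴ = (reflOp T D u W)ᴴ := by
  simp only [reflOp, conjTranspose_sub, conjTranspose_add, conjTranspose_mul, conjTranspose_smul,
    conjTranspose_sum, hT.eq, (hD _).eq, RCLike.star_def, Complex.conj_ofReal, Matrix.mul_assoc]
  rw [add_comm]

lemma trace_mul_re_nonneg {P Q : Matrix ι ι ℂ} (hP : P.PosSemidef) (hQ : Q.PosSemidef) :
    0 ≤ (P * Q).trace.re := by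
  obtain ⟨B, rfl⟩ : ∃ B, P = Bᴴ * B := by
    open scoped MatrixOrder in
    exact CStarAlgebra.nonneg_iff_eq_star_mul_self.1 (Matrix.nonneg_iff_posSemidef.2 hP)
  rw [Matrix.mul_assoc, Matrix.trace_mul_comm]
  exact (Complex.le_def.1 (hQ.mul_mul_conjTranspose_same B).trace_nonneg).1

/-- Replacing `W = P - Q` by its absolute value `P + Q` does not raise the energy: the hopping
term only depends on `W ^ 2`, and the interaction term changes by
`-4 u ∑ x, tr (P (D x) Q (D x)) ≤ 0`. -/
lemma trace_mul_reflOp_abs_le (hD : ∀ x, (D x).IsHermitian) (hu : 0 ≤ u)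
    {P Q : Matrix ι ι ℂ} (hP : P.PosSemidef) (hQ : Q.PosSemidef) (hPQ : P * Q = 0)
    (hQP : Q * P = 0) :
    ((P + Q) * reflOp T D u (P + Q)).trace.re ≤ ((P - Q) * reflOp T D u (P - Q)).trace.re := by
  have hkin : ((P + Q) * (T * (P + Q) + (P + Q) * T)).trace
      = ((P - Q) * (T * (P - Q) + (P - Q) * T)).trace := by
    have e1 : ∀ A : Matrix ι ι ℂ, (A * (T * A + A * T)).trace = 2 * (A * A * T).trace := by
      intro A
      rw [Matrix.mul_add, trace_add, ← Matrix.mul_assoc, Matrix.trace_mul_comm (A * T) A,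
        Matrix.mul_assoc A A T]
      ring
    rw [e1, e1]
    congr 3
    simp only [Matrix.mul_add, Matrix.add_mul, Matrix.mul_sub, Matrix.sub_mul, hPQ, hQP]
    abel
  have hint : ∀ x, ((P + Q) * (D x * (P + Q) * D x)).trace
      = ((P - Q) * (D x * (P - Q) * D x)).trace + 4 * (P * (D x * Q * D x)).trace := by
    intro x
    have e : (Q * (D x * P * D x)).trace = (P * (D x * Q * D x)).trace := by
      rw [Matrix.mul_assoc (D x) P, ← Matrix.mul_assoc, Matrix.trace_mul_comm]
      simp only [Matrix.mul_assoc]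
    simp only [Matrix.mul_add, Matrix.add_mul, Matrix.mul_sub, Matrix.sub_mul, trace_add,
      trace_sub, e]
    ring
  have hsum : 0 ≤ ∑ x, (P * (D x * Q * D x)).trace.re :=
    Finset.sum_nonneg fun x _ => trace_mul_re_nonneg hP (by
      simpa [(hD x).eq] using hQ.mul_mul_conjTranspose_same (D x))
  have expand : ∀ A : Matrix ι ι ℂ, (A * reflOp T D u A).trace.re
      = (A * (T * A + A * T)).trace.re - u * ∑ x, (A * (D x * A * D x)).trace.re := by
    intro A
    rw [reflOp, Matrix.mul_sub, trace_sub, Matrix.mul_smul, trace_smul, Matrix.mul_sum, trace_sum,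
      Complex.sub_re, smul_eq_mul, Complex.re_ofReal_mul, Complex.re_sum]
  rw [expand, expand, hkin]
  simp only [hint, Complex.add_re, Finset.sum_add_distrib]
  have e4 : ∀ z : ℂ, (4 * z).re = 4 * z.re := fun z => by simp
  simp only [e4, ← Finset.mul_sum]
  nlinarith [mul_nonneg hu hsum]

/-- The kernel of a positive semidefinite eigenmatrix of `reflOp` is invariant under `T` and
under every `D x`. -/
lemma PosSemidef.ker_invariant (hD : ∀ x, (D x).IsHermitian) (hu : 0 < u) {E : ℝ}
    {R : Matrix ι ι ℂ} (hR : R.PosSemidef) (hRE : reflOp T D u R = (E : ℂ) • R) {v : ι → ℂ}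
    (hv : R *ᵥ v = 0) : R *ᵥ (T *ᵥ v) = 0 ∧ ∀ x, R *ᵥ (D x *ᵥ v) = 0 := by
  have hL : reflOp T D u R *ᵥ v
      = R *ᵥ (T *ᵥ v) - (u : ℂ) • ∑ x, D x *ᵥ (R *ᵥ (D x *ᵥ v)) := by
    simp only [reflOp, sub_mulVec, add_mulVec, smul_mulVec, sum_mulVec, ← mulVec_mulVec, hv,
      mulVec_zero, zero_add]
  rw [hRE, smul_mulVec, hv, smul_zero] at hL
  have hleft : ∀ w, star v ⬝ᵥ R *ᵥ w = 0 := fun w => by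
    rw [← IsHermitian.star_dotProduct_mulVec hR.isHermitian, hv]; simp
  have hsum : ∑ x, star (D x *ᵥ v) ⬝ᵥ R *ᵥ (D x *ᵥ v) = 0 := by
    have h := congrArg (fun w => star v ⬝ᵥ w) hL
    simp only [dotProduct_sub, dotProduct_smul, hleft, dotProduct_zero, zero_sub,
      dotProduct_sum] at h
    have hu' : (u : ℂ) ≠ 0 := by exact_mod_cast hu.ne'
    have h' := (smul_eq_zero.1 (neg_eq_zero.1 h.symm)).resolve_left hu'
    rw [← h']
    exact Finset.sum_congr rfl fun x _ => IsHermitian.star_dotProduct_mulVec (hD x) _ _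
  have hx : ∀ x, R *ᵥ (D x *ᵥ v) = 0 := fun x =>
    (hR.dotProduct_mulVec_zero_iff _).1
      ((Finset.sum_eq_zero_iff_of_nonneg fun x _ => hR.dotProduct_mulVec_nonneg _).1 hsum x
        (Finset.mem_univ x))
  refine ⟨?_, hx⟩
  simpa [hx] using hL.symm

/-- A Hermitian eigenmatrix of `reflOp` for the lowest eigenvalue is semidefinite. Its positive and
negative parts are again eigenmatrices; the columns of one are in the kernel of the other, which
irreducibility forces to be everything. -/
theorem posSemidef_or_neg_of_ground (hD : ∀ x, (D x).IsHermitian)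
    (hu : 0 < u)
    (hirr : ∀ K : Submodule ℂ (ι → ℂ), (∀ v ∈ K, T *ᵥ v ∈ K) → (∀ x, ∀ v ∈ K, D x *ᵥ v ∈ K) →
      ∀ v ∈ K, ∀ i, p i → v i ≠ 0 → ∀ j, p j → Pi.single j 1 ∈ K)
    {E : ℝ}
    (hmin : ∀ W, SupportedOn p W → (Wᴴ * reflOp T D u W).trace.re ≤ E * (Wᴴ * W).trace.re →
      reflOp T D u W = (E : ℂ) • W)
    {W : Matrix ι ι ℂ} (hW : W.IsHermitian) (hsupp : SupportedOn p W)
    (hWE : reflOp T D u W = (E : ℂ) • W) : W.PosSemidef ∨ (-W).PosSemidef := by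
  obtain ⟨P, Q, hP, hQ, hWPQ, hPQ, hQP, ⟨G, hG1, hG2⟩, ⟨G', hG1', hG2'⟩⟩ :=
    IsHermitian.exists_pos_sub_neg hW
  have supp : ∀ R G : Matrix ι ι ℂ, R = W * G → R = G * W → SupportedOn p R := by
    intro R G h1 h2 i j hij
    constructor
    · rw [h1, mul_apply] at hij
      obtain ⟨k, -, hk⟩ := Finset.exists_ne_zero_of_sum_ne_zero hij
      exact (hsupp _ _ (left_ne_zero_of_mul hk)).1
    · rw [h2, mul_apply] at hij
      obtain ⟨k, -, hk⟩ := Finset.exists_ne_zero_of_sum_ne_zero hij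
      exact (hsupp _ _ (right_ne_zero_of_mul hk)).2
  have hPs := supp P G hG1 hG2
  have hQs := supp Q G' hG1' hG2'
  have hAs : SupportedOn p (P + Q) := fun i j hij => by
    by_cases h : P i j = 0
    · exact hQs i j fun h' => hij (by simp [h, h'])
    · exact hPs i j h
  have hA : (P + Q).IsHermitian := hP.isHermitian.add hQ.isHermitian
  have hAE : reflOp T D u (P + Q) = (E : ℂ) • (P + Q) := by
    apply hmin _ hAs
    rw [hA.eq]
    refine (trace_mul_reflOp_abs_le hD hu.le hP hQ hPQ hQP).trans ?_
    rw [← hWPQ, hWE, Matrix.mul_smul, trace_smul, smul_eq_mul, Complex.re_ofReal_mul]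
    apply le_of_eq
    congr 3
    rw [hWPQ]
    simp only [Matrix.mul_add, Matrix.add_mul, Matrix.mul_sub, Matrix.sub_mul, hPQ, hQP]
    abel
  have hPE : reflOp T D u P = (E : ℂ) • P := by
    have h : P = (1 / 2 : ℂ) • ((P + Q) + W) := by
      rw [hWPQ, add_add_sub_cancel, ← two_smul ℂ P, smul_smul]; norm_num
    rw [h, reflOp_smul, reflOp_add, hAE, hWE, ← smul_add, smul_comm]
  by_cases hQ0 : Q = 0
  · left; rwa [hWPQ, hQ0, sub_zero]
  right
  obtain ⟨i, j, hij⟩ : ∃ i j, Q i j ≠ 0 := by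
    by_contra h
    push Not at h
    exact hQ0 (Matrix.ext h)
  have hker := hirr (LinearMap.ker P.mulVecLin)
    (fun v hv => (PosSemidef.ker_invariant hD hu hP hPE hv).1)
    (fun x v hv => (PosSemidef.ker_invariant hD hu hP hPE hv).2 x)
    (fun i => Q i j) (by
      have := congrArg (fun M => fun i => M i j) hPQ
      exact this) i (hQs i j hij).1 hij
  have hP0 : P = 0 := by
    ext a b
    by_contra hab
    have h := hker b (hPs a b hab).2
    rw [LinearMap.mem_ker, mulVecLin_apply, mulVec_single_one] at h
    exact hab (congrFun h a)
  rwa [hWPQ, hP0, zero_sub, neg_neg]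

/-- A matrix attaining the lowest eigenvalue of `reflOp` vanishes if it is orthogonal to a
diagonal matrix with positive entries. -/
theorem eq_zero_of_ground_of_trace_eq_zero (hT : T.IsHermitian) (hD : ∀ x, (D x).IsHermitian)
    (hu : 0 < u)
    (hirr : ∀ K : Submodule ℂ (ι → ℂ), (∀ v ∈ K, T *ᵥ v ∈ K) → (∀ x, ∀ v ∈ K, D x *ᵥ v ∈ K) →
      ∀ v ∈ K, ∀ i, p i → v i ≠ 0 → ∀ j, p j → Pi.single j 1 ∈ K)
    {E : ℝ}
    (hmin : ∀ W, SupportedOn p W → (Wᴴ * reflOp T D u W).trace.re ≤ E * (Wᴴ * W).trace.re →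
      reflOp T D u W = (E : ℂ) • W)
    {w : ι → ℝ} (hw : ∀ i, p i → 0 < w i)
    {W : Matrix ι ι ℂ} (hsupp : SupportedOn p W) (hWE : reflOp T D u W = (E : ℂ) • W)
    (htr : ∑ i, (w i : ℂ) * W i i = 0) : W = 0 := by
  have hpsd : ∀ R : Matrix ι ι ℂ, R.PosSemidef → SupportedOn p R →
      ∑ i, (w i : ℂ) * R i i = 0 → R = 0 := by
    intro R hR hRs hRt
    rw [← hR.trace_eq_zero_iff, trace]
    refine Finset.sum_eq_zero fun i _ => ?_
    by_contra hi
    have hnn : ∀ i ∈ Finset.univ, 0 ≤ (w i : ℂ) * R i i := by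
      intro k _
      by_cases hk : R k k = 0
      · simp [hk]
      · exact mul_nonneg (by exact_mod_cast (hw k (hRs k k hk).1).le) hR.diag_nonneg
    have h := (Finset.sum_eq_zero_iff_of_nonneg hnn).1 hRt i (Finset.mem_univ i)
    have hwi := (hw i (hRs i i hi).1).ne'
    exact (mul_ne_zero (by exact_mod_cast hwi) hi) h
  have hherm : ∀ R : Matrix ι ι ℂ, R.IsHermitian → SupportedOn p R →
      reflOp T D u R = (E : ℂ) • R → ∑ i, (w i : ℂ) * R i i = 0 → R = 0 := by
    intro R hR hRs hRE hRt
    rcases posSemidef_or_neg_of_ground hD hu hirr hmin hR hRs hRE with h | h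
    · exact hpsd R h hRs hRt
    · refine neg_eq_zero.1 (hpsd (-R) h (fun i j hij => hRs i j (by simpa using hij)) ?_)
      simpa using hRt
  have hsupp' : SupportedOn p Wᴴ := fun i j hij => (hsupp j i (by simpa using hij)).symm
  have hWE' : reflOp T D u Wᴴ = (E : ℂ) • Wᴴ := by
    rw [reflOp_conjTranspose hT hD, hWE, conjTranspose_smul]; simp
  have htr' : ∑ i, (w i : ℂ) * Wᴴ i i = 0 := by
    have := congrArg star htr
    simpa [mul_comm] using this
  have h1 : W + Wᴴ = 0 := by
    apply hherm _ (by simp [IsHermitian, add_comm])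
    · intro i j hij
      by_cases h : W i j = 0
      · exact hsupp' i j fun h' => hij (by simp only [Matrix.add_apply, h, h', add_zero])
      · exact hsupp i j h
    · rw [reflOp_add, hWE, hWE', smul_add]
    · simp only [Matrix.add_apply, mul_add, Finset.sum_add_distrib, htr, htr', add_zero]
  have h2 : Complex.I • (W - Wᴴ) = 0 := by
    apply hherm
    · simp [IsHermitian, ← smul_neg]
    · intro i j hij
      by_cases h : W i j = 0
      · exact hsupp' i j fun h' => hij (by simp only [Matrix.smul_apply, Matrix.sub_apply,
          h, h', sub_zero, smul_zero])
      · exact hsupp i j h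
    · rw [reflOp_smul, reflOp_sub, hWE, hWE', ← smul_sub, smul_comm]
    · simp only [Matrix.smul_apply, Matrix.sub_apply, smul_eq_mul, mul_sub,
        mul_left_comm _ Complex.I, ← Finset.mul_sum, Finset.sum_sub_distrib, htr, htr', sub_zero,
        mul_zero]
  have h3 : W - Wᴴ = 0 := (smul_eq_zero.1 h2).resolve_left Complex.I_ne_zero
  have h4 : (2 : ℂ) • W = 0 := by
    rw [two_smul, ← add_zero (W + W), ← add_zero (W + W + 0)]
    calc W + W + 0 + 0 = (W + Wᴴ) + (W - Wᴴ) := by abel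
      _ = 0 := by rw [h1, h3, add_zero]
  exact (smul_eq_zero.1 h4).resolve_left two_ne_zero

end Reflection

/-! ### The spin algebra -/

noncomputable section SpinAlgebra

variable {Λ : Type*} [Fintype Λ] [LinearOrder Λ]

/-- The operator `∑ x, c†_{x,σ} c_{x,τ}`. For `σ ≠ τ` these are the spin raising and lowering
operators, for `σ = τ` the numbers of electrons with spin `σ`. -/
def spinHop (σ τ : Fin 2) : Op Λ := ∑ x, cDag x σ * c x τ

lemma spinHop_conjTranspose (σ τ : Fin 2) : (spinHop σ τ : Op Λ)ᴴ = spinHop τ σ := by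
  simp [spinHop, cDag, conjTranspose_sum, conjTranspose_mul]

lemma c_mul_cDag (x y : Λ) (σ τ : Fin 2) :
    c x σ * cDag y τ = (if y = x ∧ τ = σ then 1 else 0) - cDag y τ * c x σ := by
  rw [← cDag_c_anticomm, add_sub_cancel_left]

lemma hop_mul_hop (x y z w : Λ) (σ τ μ ν : Fin 2) :
    (cDag x σ * c y τ) * (cDag z μ * c w ν) - (cDag z μ * c w ν) * (cDag x σ * c y τ)
      = (if z = y ∧ μ = τ then cDag x σ * c w ν else 0)
        - (if x = w ∧ σ = ν then cDag z μ * c y τ else 0) := by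
  have h1 : (cDag x σ * c y τ) * (cDag z μ * c w ν)
      = (if z = y ∧ μ = τ then cDag x σ * c w ν else 0)
        - cDag x σ * cDag z μ * (c y τ * c w ν) := by
    rw [Matrix.mul_assoc, ← Matrix.mul_assoc (c y τ), c_mul_cDag, Matrix.sub_mul, Matrix.mul_sub]
    split_ifs <;> simp [Matrix.mul_assoc]
  have h2 : (cDag z μ * c w ν) * (cDag x σ * c y τ)
      = (if x = w ∧ σ = ν then cDag z μ * c y τ else 0)
        - cDag z μ * cDag x σ * (c w ν * c y τ) := by
    rw [Matrix.mul_assoc, ← Matrix.mul_assoc (c w ν), c_mul_cDag, Matrix.sub_mul, Matrix.mul_sub]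
    split_ifs <;> simp [Matrix.mul_assoc]
  rw [h1, h2, eq_neg_of_add_eq_zero_left (cDag_anticomm z x μ σ),
    eq_neg_of_add_eq_zero_left (c_anticomm w y ν τ), Matrix.neg_mul, Matrix.mul_neg, neg_neg]
  abel

lemma hop_mul_spinHop (x y : Λ) (σ τ μ ν : Fin 2) :
    (cDag x σ * c y τ) * spinHop μ ν - spinHop μ ν * (cDag x σ * c y τ)
      = (if μ = τ then cDag x σ * c y ν else 0) - (if σ = ν then cDag x μ * c y τ else 0) := by
  rw [spinHop, Matrix.mul_sum, Matrix.sum_mul, ← Finset.sum_sub_distrib]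
  simp_rw [hop_mul_hop, Finset.sum_sub_distrib, ite_and]
  simp

lemma spinHop_mul_spinHop (σ τ μ ν : Fin 2) :
    (spinHop σ τ * spinHop μ ν - spinHop μ ν * spinHop σ τ : Op Λ)
      = (if μ = τ then spinHop σ ν else 0) - (if σ = ν then spinHop μ τ else 0) := by
  rw [spinHop, Matrix.mul_sum, Matrix.sum_mul, ← Finset.sum_sub_distrib]
  simp_rw [hop_mul_spinHop, Finset.sum_sub_distrib]
  congr 1 <;> split_ifs <;> simp [spinHop]

lemma sum_hop_commute_spinHop (x y : Λ) (μ ν : Fin 2) :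
    Commute (∑ σ, cDag x σ * c y σ) (spinHop μ ν) := by
  rw [commute_iff_eq, ← sub_eq_zero, Matrix.sum_mul, Matrix.mul_sum, ← Finset.sum_sub_distrib]
  simp_rw [hop_mul_spinHop, Finset.sum_sub_distrib]
  simp

lemma num_mul_self (x : Λ) (σ : Fin 2) : num x σ * num x σ = num x σ := by
  have hcc : c x σ * c x σ = 0 := by
    have h := c_anticomm x x σ σ
    rw [← two_smul ℂ] at h
    exact (smul_eq_zero.1 h).resolve_left two_ne_zero
  rw [num, Matrix.mul_assoc, ← Matrix.mul_assoc (c x σ), c_mul_cDag, Matrix.sub_mul,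
    Matrix.mul_assoc (cDag x σ) (c x σ), hcc]
  simp

lemma num_commute (x y : Λ) (σ τ : Fin 2) : Commute (num x σ) (num y τ) := by
  rw [commute_iff_eq, ← sub_eq_zero, num, num, hop_mul_hop]
  by_cases h : y = x ∧ τ = σ
  · obtain ⟨rfl, rfl⟩ := h; simp
  · have h' : ¬ (x = y ∧ σ = τ) := fun h' => h ⟨h'.1.symm, h'.2.symm⟩
    simp [h, h']

lemma hamiltonian_commute_spinHop (t : Λ → Λ → ℝ) (U : Λ → ℝ) (μ ν : Fin 2) :
    Commute (hamiltonian t U) (spinHop μ ν) := by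
  apply Commute.add_left
  · refine Commute.sum_left _ _ _ fun x _ => Commute.sum_left _ _ _ fun y _ => ?_
    rw [← Finset.smul_sum]
    exact (sum_hop_commute_spinHop x y μ ν).smul_left _
  · refine Commute.sum_left _ _ _ fun x _ => Commute.smul_left ?_ _
    have hm := sum_hop_commute_spinHop x x μ ν
    set m : Op Λ := ∑ σ, cDag x σ * c x σ with hmdef
    have hm' : m = num x 0 + num x 1 := by rw [hmdef, Fin.sum_univ_two]; rfl
    have h : num x 0 * num x 1 = (1 / 2 : ℂ) • (m * m - m) := by
      rw [hm', Matrix.add_mul, Matrix.mul_add, Matrix.mul_add, num_mul_self, num_mul_self,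
        (num_commute x x 1 0).eq,
        show ∀ a b d : Op Λ, a + d + (d + b) - (a + b) = (2 : ℂ) • d from
          fun a b d => by rw [two_smul]; abel, smul_smul]
      norm_num
    rw [h]
    exact ((hm.mul_left hm).sub_left hm).smul_left _

lemma hamiltonian_isHermitian {t : Λ → Λ → ℝ} (ht : ∀ x y, t x y = t y x) (U : Λ → ℝ) :
    (hamiltonian t U).IsHermitian := by
  have hnum : ∀ (x : Λ) σ, (num x σ)ᴴ = num x σ := fun x σ => by
    simp [num, cDag, conjTranspose_mul]
  refine IsHermitian.add ?_ ?_
  · unfold IsHermitian hopping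
    simp only [conjTranspose_sum, conjTranspose_smul, conjTranspose_mul, cDag,
      conjTranspose_conjTranspose, RCLike.star_def, Complex.conj_ofReal]
    rw [Finset.sum_comm]
    refine Finset.sum_congr rfl fun x _ => Finset.sum_congr rfl fun y _ => ?_
    rw [ht]
  · unfold IsHermitian interaction
    rw [conjTranspose_sum]
    refine Finset.sum_congr rfl fun x _ => ?_
    rw [conjTranspose_smul, conjTranspose_mul, hnum, hnum, (num_commute x x 1 0).eq]
    simp

lemma totalNum_eq : (totalNum : Op Λ) = spinHop 0 0 + spinHop 1 1 := by
  simp [totalNum, spinHop, num, Finset.sum_add_distrib]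

lemma totalSpin_eq (α : Fin 3) :
    (totalSpin α : Op Λ) = (1 / 2 : ℂ) • ∑ σ, ∑ τ, pauli α σ τ • spinHop σ τ := by
  simp only [totalSpin, spin, spinHop, ← Finset.smul_sum]
  congr 1
  rw [Finset.sum_comm]
  refine Finset.sum_congr rfl fun σ _ => ?_
  rw [Finset.sum_comm]
  simp only [← Finset.smul_sum]

lemma raise_mul_lower : (spinHop 0 1 * spinHop 1 0 : Op Λ)
    = spinHop 1 0 * spinHop 0 1 + (spinHop 0 0 - spinHop 1 1) := by
  have h := spinHop_mul_spinHop (Λ := Λ) 0 1 1 0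
  simp only [if_true] at h
  rw [← h]; abel

/-- `𝐒² = S⁻ S⁺ + S³ (S³ + 1)`, with `2 S³ = N_↑ - N_↓`. -/
lemma totalSpinSq_eq : (totalSpinSq : Op Λ) = spinHop 1 0 * spinHop 0 1
    + (1 / 4 : ℂ) • ((spinHop 0 0 - spinHop 1 1) * (spinHop 0 0 - spinHop 1 1))
    + (1 / 2 : ℂ) • (spinHop 0 0 - spinHop 1 1) := by
  simp only [totalSpinSq, totalSpin_eq, Fin.sum_univ_three, Fin.sum_univ_two, pauli]
  simp only [cons_val_zero, cons_val_one, cons_val, of_apply, zero_smul, one_smul, zero_add,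
    add_zero, neg_smul]
  simp only [Matrix.mul_smul, Matrix.smul_mul, Matrix.add_mul, Matrix.mul_add, smul_add, smul_smul,
    Matrix.neg_mul, Matrix.mul_neg, smul_neg, raise_mul_lower, neg_add, neg_neg, smul_sub,
    Matrix.sub_mul, Matrix.mul_sub]
  ring_nf
  simp only [Complex.I_sq]
  module

/-- Spin states: eigenvectors of the total spin operator, at fixed particle number. -/
def spinSpace (Ne : ℕ) (S : ℝ) : Submodule ℂ (State Λ) :=
  LinearMap.ker (totalNum - (Ne : ℂ) • (1 : Op Λ)).mulVecLin ⊓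
    LinearMap.ker (totalSpinSq - ((S * (S + 1) : ℝ) : ℂ) • (1 : Op Λ)).mulVecLin

lemma mem_spinSpace {Ne : ℕ} {S : ℝ} {Φ : State Λ} :
    Φ ∈ spinSpace Ne S ↔ totalNum *ᵥ Φ = (Ne : ℂ) • Φ ∧
      totalSpinSq *ᵥ Φ = ((S * (S + 1) : ℝ) : ℂ) • Φ := by
  simp only [spinSpace, Submodule.mem_inf, LinearMap.mem_ker, mulVecLin_apply, sub_mulVec,
    smul_mulVec, one_mulVec, sub_eq_zero]

/-- The states with `n` up electrons and `m` down electrons. -/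
def sector (n m : ℕ) : Submodule ℂ (State Λ) :=
  LinearMap.ker (spinHop 0 0 - (n : ℂ) • (1 : Op Λ)).mulVecLin ⊓
    LinearMap.ker (spinHop 1 1 - (m : ℂ) • (1 : Op Λ)).mulVecLin

lemma mem_sector {n m : ℕ} {Φ : State Λ} :
    Φ ∈ sector n m ↔ spinHop 0 0 *ᵥ Φ = (n : ℂ) • Φ ∧ spinHop 1 1 *ᵥ Φ = (m : ℂ) • Φ := by
  simp only [sector, Submodule.mem_inf, LinearMap.mem_ker, mulVecLin_apply, sub_mulVec,
    smul_mulVec, one_mulVec, sub_eq_zero]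

lemma mulVec_comm_of_commute {ι : Type*} [Fintype ι] {A B : Matrix ι ι ℂ} (h : Commute A B)
    (Φ : ι → ℂ) :
    A *ᵥ (B *ᵥ Φ) = B *ᵥ (A *ᵥ Φ) := by
  rw [mulVec_mulVec, h.eq, mulVec_mulVec]

lemma mulVec_mem_sector {H : Op Λ} (hH : ∀ μ ν, Commute H (spinHop μ ν)) {n m : ℕ} {Φ : State Λ}
    (hΦ : Φ ∈ sector n m) : H *ᵥ Φ ∈ sector n m := by
  rw [mem_sector] at hΦ ⊢
  rw [← mulVec_comm_of_commute (hH 0 0), ← mulVec_comm_of_commute (hH 1 1), hΦ.1, hΦ.2,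
    mulVec_smul, mulVec_smul]
  exact ⟨rfl, rfl⟩

lemma commute_totalNum_of_commute_spinHop {H : Op Λ} (hH : ∀ μ ν, Commute H (spinHop μ ν)) :
    Commute H totalNum := by
  rw [totalNum_eq]; exact (hH 0 0).add_right (hH 1 1)

lemma commute_totalSpinSq_of_commute_spinHop {H : Op Λ} (hH : ∀ μ ν, Commute H (spinHop μ ν)) :
    Commute H totalSpinSq := by
  have h3 := (hH 0 0).sub_right (hH 1 1)
  rw [totalSpinSq_eq]
  exact (((hH 1 0).mul_right (hH 0 1)).add_right ((h3.mul_right h3).smul_right _)).add_right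
    (h3.smul_right _)

lemma mulVec_mem_spinSpace {H : Op Λ} (hH : ∀ μ ν, Commute H (spinHop μ ν)) {Ne : ℕ} {S : ℝ}
    {Φ : State Λ} (hΦ : Φ ∈ spinSpace Ne S) : H *ᵥ Φ ∈ spinSpace Ne S := by
  rw [mem_spinSpace] at hΦ ⊢
  rw [← mulVec_comm_of_commute (commute_totalNum_of_commute_spinHop hH),
    ← mulVec_comm_of_commute (commute_totalSpinSq_of_commute_spinHop hH), hΦ.1, hΦ.2,
    mulVec_smul, mulVec_smul]
  exact ⟨rfl, rfl⟩

/-- Twice the total spin squared is the quadratic Casimir operator of `gl₂` up to a function of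
the particle number. -/
lemma totalSpinSq_eq_casimir : (totalSpinSq : Op Λ)
    = (1 / 2 : ℂ) • (∑ σ, ∑ τ, spinHop σ τ * spinHop τ σ)
      - (1 / 4 : ℂ) • (totalNum * totalNum) := by
  have h00 : (spinHop 0 0 * spinHop 1 1 : Op Λ) = spinHop 1 1 * spinHop 0 0 := by
    have h := spinHop_mul_spinHop (Λ := Λ) 0 0 1 1
    simpa [sub_eq_zero] using h
  rw [totalSpinSq_eq, totalNum_eq]
  simp only [Fin.sum_univ_two, Matrix.add_mul, Matrix.mul_add, Matrix.sub_mul, Matrix.mul_sub,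
    raise_mul_lower, h00]
  module

lemma totalNum_commute_spinHop (μ ν : Fin 2) : Commute (totalNum : Op Λ) (spinHop μ ν) := by
  have h : (totalNum : Op Λ) = ∑ x, ∑ σ, cDag x σ * c x σ := by
    simp only [totalNum, Fin.sum_univ_two]; rfl
  rw [h]
  exact Commute.sum_left _ _ _ fun x _ => sum_hop_commute_spinHop x x μ ν

lemma totalSpinSq_commute_spinHop (μ ν : Fin 2) :
    Commute (totalSpinSq : Op Λ) (spinHop μ ν) := by
  have hN := totalNum_commute_spinHop (Λ := Λ) μ ν
  rw [totalSpinSq_eq_casimir]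
  refine Commute.sub_left (Commute.smul_left ?_ _) ((hN.mul_left hN).smul_left _)
  rw [commute_iff_eq, ← sub_eq_zero, Matrix.sum_mul, Matrix.mul_sum, ← Finset.sum_sub_distrib]
  have key : ∀ σ τ : Fin 2, (spinHop σ τ * spinHop τ σ * spinHop μ ν
      - spinHop μ ν * (spinHop σ τ * spinHop τ σ) : Op Λ)
      = spinHop σ τ * ((if μ = σ then spinHop τ ν else 0) - (if τ = ν then spinHop μ σ else 0))
        + ((if μ = τ then spinHop σ ν else 0) - (if σ = ν then spinHop μ τ else 0))
          * spinHop τ σ := by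
    intro σ τ
    rw [← spinHop_mul_spinHop, ← spinHop_mul_spinHop]
    noncomm_ring
  simp_rw [Matrix.sum_mul, Matrix.mul_sum, ← Finset.sum_sub_distrib, key]
  fin_cases μ <;> fin_cases ν <;> simp [Fin.sum_univ_two] <;> noncomm_ring

end SpinAlgebra

/-! ### Half filling as an attractive model of up electrons and down holes -/

noncomputable section ParticleHole

variable {Λ : Type*} [Fintype Λ] [LinearOrder Λ]

/-- The occupation number of the site `x` for one species. -/
def occ (x : Λ) : Matrix (Finset Λ) (Finset Λ) ℂ := diagonal fun X => if x ∈ X then 1 else 0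

/-- The hopping Hamiltonian of one species. -/
def hop (t : Λ → Λ → ℝ) : Matrix (Finset Λ) (Finset Λ) ℂ :=
  ∑ x, ∑ y, (t x y : ℂ) • ((ann x)ᴴ * ann y)

/-- The state whose coordinate at `(X, Y)` is the matrix entry `F X Y`. -/
def toState (F : Matrix (Finset Λ) (Finset Λ) ℂ) : State Λ := fun p => F p.1 p.2

lemma ann_conjTranspose_mul_ann (x : Λ) : (ann x)ᴴ * ann x = occ x := by
  ext X Z
  rw [annT_mul_apply, ann_apply, occ, diagonal_apply]
  by_cases hx : x ∈ X
  · by_cases hZ : X = Z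
    · subst hZ; simp [hx, jwSign_mul_self]
    · simp [hx, hZ, Ne.symm hZ]
  · simp [hx]

lemma ann_mul_ann_conjTranspose (x y : Λ) :
    ann x * (ann y)ᴴ = (if y = x then 1 else 0) - (ann y)ᴴ * ann x := by
  rw [← annT_anticomm, add_sub_cancel_left]

lemma occ_isHermitian (x : Λ) : (occ x).IsHermitian := by
  rw [IsHermitian, occ, diagonal_conjTranspose]
  congr 1; ext X; by_cases h : x ∈ X <;> simp [h]

lemma hop_isHermitian {t : Λ → Λ → ℝ} (ht : ∀ x y, t x y = t y x) : (hop t).IsHermitian := by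
  unfold IsHermitian hop
  simp only [conjTranspose_sum, conjTranspose_smul, conjTranspose_mul,
    conjTranspose_conjTranspose, RCLike.star_def, Complex.conj_ofReal]
  rw [Finset.sum_comm]
  refine Finset.sum_congr rfl fun x _ => Finset.sum_congr rfl fun y _ => ?_
  rw [ht]

lemma ann_transpose (x : Λ) : (ann x)ᵀ = (ann x)ᴴ := by
  ext X Y
  rw [transpose_apply, conjTranspose_apply, ann_apply]
  split_ifs
  · rw [star_jwSign]
  · simp

lemma ann_conjTranspose_transpose (x : Λ) : ((ann x)ᴴ)ᵀ = ann x := by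
  rw [← ann_transpose, transpose_transpose]

lemma hop_transpose {t : Λ → Λ → ℝ} (ht : ∀ x y, t x y = t y x) : (hop t)ᵀ = hop t := by
  unfold hop
  simp only [transpose_sum, transpose_smul, transpose_mul, ann_conjTranspose_transpose,
    ann_transpose]
  rw [Finset.sum_comm]
  refine Finset.sum_congr rfl fun x _ => Finset.sum_congr rfl fun y _ => ?_
  rw [ht]

lemma kronecker_mulVec_toState (P Q F : Matrix (Finset Λ) (Finset Λ) ℂ) :
    (P ⊗ₖ Q) *ᵥ toState F = toState (P * F * Qᵀ) := by
  ext ⟨X, Y⟩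
  simp only [mulVec, dotProduct, toState, kroneckerMap_apply, mul_apply, transpose_apply,
    Fintype.sum_prod_type, Finset.sum_mul]
  rw [Finset.sum_comm]
  refine Finset.sum_congr rfl fun Z _ => Finset.sum_congr rfl fun W _ => by ring

lemma toState_add (F G : Matrix (Finset Λ) (Finset Λ) ℂ) :
    toState (F + G) = toState F + toState G := rfl

lemma toState_smul (a : ℂ) (F : Matrix (Finset Λ) (Finset Λ) ℂ) :
    toState (a • F) = a • toState F := rfl

lemma toState_sum {κ : Type*} (s : Finset κ) (F : κ → Matrix (Finset Λ) (Finset Λ) ℂ) :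
    toState (∑ k ∈ s, F k) = ∑ k ∈ s, toState (F k) := by
  ext p; simp [toState, Matrix.sum_apply]

lemma toState_injective : Function.Injective (toState : Matrix (Finset Λ) (Finset Λ) ℂ → _) :=
  fun _ _ h => Matrix.ext fun X Y => congrFun h (X, Y)

lemma star_toState_dotProduct (F G : Matrix (Finset Λ) (Finset Λ) ℂ) :
    star (toState F) ⬝ᵥ toState G = (Fᴴ * G).trace := by
  simp only [dotProduct, toState, trace, diag_apply, mul_apply, Fintype.sum_prod_type,
    conjTranspose_apply, Pi.star_apply]
  rw [Finset.sum_comm]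

lemma cDag_mul_c_up (x y : Λ) : cDag x 0 * c y 0
    = ((ann x)ᴴ * ann y) ⊗ₖ (1 : Matrix (Finset Λ) (Finset Λ) ℂ) := by
  simp [cDag, c, conjTranspose_kronecker, ← mul_kronecker_mul]

lemma cDag_mul_c_down (x y : Λ) : cDag x 1 * c y 1
    = (1 : Matrix (Finset Λ) (Finset Λ) ℂ) ⊗ₖ ((ann x)ᴴ * ann y) := by
  simp [cDag, c, conjTranspose_kronecker, ← mul_kronecker_mul, parity_conjTranspose,
    parity_mul_parity]

lemma cDag_mul_c_up_down (x y : Λ) : cDag x 0 * c y 1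
    = ((ann x)ᴴ * parity) ⊗ₖ ann y := by
  simp [cDag, c, conjTranspose_kronecker, ← mul_kronecker_mul]

lemma sum_occ : (∑ x, occ x : Matrix (Finset Λ) (Finset Λ) ℂ)
    = diagonal fun X => (X.card : ℂ) := by
  ext X Y
  by_cases h : X = Y
  · subst h; simp [Matrix.sum_apply, occ]
  · simp [Matrix.sum_apply, occ, h]

lemma spinHop_up_eq_diagonal : (spinHop 0 0 : Op Λ) = diagonal fun p => (p.1.card : ℂ) := by
  simp only [spinHop, cDag_mul_c_up, ann_conjTranspose_mul_ann]
  have := sum_occ (Λ := Λ)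
  ext p q
  have h2 := congrFun (congrFun this p.1) q.1
  rw [Matrix.sum_apply] at h2
  simp only [Matrix.sum_apply, kroneckerMap_apply, ← Finset.sum_mul, h2]
  by_cases hp : p.1 = q.1 <;> by_cases hq : p.2 = q.2 <;>
    simp [diagonal_apply, Matrix.one_apply, Prod.ext_iff, hp, hq]

lemma spinHop_up_mulVec_apply (Φ : State Λ) (p : Config Λ) :
    (spinHop 0 0 *ᵥ Φ) p = (p.1.card : ℂ) * Φ p := by
  rw [spinHop_up_eq_diagonal, mulVec_diagonal]

lemma spinHop_down_mulVec_apply (Φ : State Λ) (p : Config Λ) :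
    (spinHop 1 1 *ᵥ Φ) p = (p.2.card : ℂ) * Φ p := by
  have h : (spinHop 1 1 : Op Λ) = diagonal fun p => (p.2.card : ℂ) := by
    simp only [spinHop, cDag_mul_c_down, ann_conjTranspose_mul_ann]
    have := sum_occ (Λ := Λ)
    ext p q
    have h2 := congrFun (congrFun this p.2) q.2
    rw [Matrix.sum_apply] at h2
    simp only [Matrix.sum_apply, kroneckerMap_apply, ← Finset.mul_sum, h2]
    by_cases hp : p.1 = q.1 <;> by_cases hq : p.2 = q.2 <;>
      simp [diagonal_apply, Matrix.one_apply, Prod.ext_iff, hp, hq]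
  rw [h, mulVec_diagonal]

lemma mem_sector_iff {n m : ℕ} {Φ : State Λ} :
    Φ ∈ sector n m ↔ ∀ X Y, Φ (X, Y) ≠ 0 → X.card = n ∧ Y.card = m := by
  simp only [mem_sector, funext_iff, spinHop_up_mulVec_apply, spinHop_down_mulVec_apply,
    Pi.smul_apply, smul_eq_mul, mul_eq_mul_right_iff, Nat.cast_inj, Prod.forall]
  constructor
  · intro h X Y hXY
    exact ⟨(h.1 X Y).resolve_right hXY, (h.2 X Y).resolve_right hXY⟩
  · intro h
    refine ⟨fun X Y => ?_, fun X Y => ?_⟩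
    · by_cases hXY : Φ (X, Y) = 0
      · exact Or.inr hXY
      · exact Or.inl (h X Y hXY).1
    · by_cases hXY : Φ (X, Y) = 0
      · exact Or.inr hXY
      · exact Or.inl (h X Y hXY).2

lemma hamiltonian_mulVec_toState {t : Λ → Λ → ℝ} (ht : ∀ x y, t x y = t y x) (U : ℝ)
    (F : Matrix (Finset Λ) (Finset Λ) ℂ) :
    hamiltonian t (fun _ => U) *ᵥ toState F
      = toState (hop t * F + F * hop t + (U : ℂ) • ∑ x, occ x * F * occ x) := by
  have hocc : ∀ x : Λ, (occ x)ᵀ = occ x := fun x => diagonal_transpose _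
  have h1 : (hopping t : Op Λ) = hop t ⊗ₖ (1 : Matrix (Finset Λ) (Finset Λ) ℂ)
      + (1 : Matrix (Finset Λ) (Finset Λ) ℂ) ⊗ₖ hop t := by
    simp only [hopping, Fin.sum_univ_two, cDag_mul_c_up, cDag_mul_c_down,
      Finset.sum_add_distrib, hop]
    congr 1
    · ext p q
      simp only [Matrix.sum_apply, Matrix.smul_apply, kroneckerMap_apply, Finset.sum_mul,
        smul_mul_assoc]
    · ext p q
      simp only [Matrix.sum_apply, Matrix.smul_apply, kroneckerMap_apply, Finset.mul_sum,
        mul_smul_comm]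
  have h2 : ∀ x : Λ, num x 0 * num x 1 = occ x ⊗ₖ occ x := fun x => by
    rw [num, num, cDag_mul_c_up, cDag_mul_c_down, ann_conjTranspose_mul_ann,
      ← mul_kronecker_mul, Matrix.mul_one, Matrix.one_mul]
  simp only [hamiltonian, h1, interaction, h2, add_mulVec, sum_mulVec, smul_mulVec,
    kronecker_mulVec_toState, hop_transpose ht, hocc, transpose_one, Matrix.mul_one,
    Matrix.one_mul, toState_add, toState_smul, toState_sum, Finset.smul_sum]

/-- The sign of the sublattice: `1` on `A` and `-1` off `A`. -/
def sgn (A : Finset Λ) (x : Λ) : ℂ := if x ∈ A then 1 else -1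

/-- The sign with which the particle-hole transformation maps the basis vector of `C` to the one
of the complement of `C`. -/
def phSign (A C : Finset Λ) : ℂ :=
  ∏ x ∈ C, (sgn A x * (-1) ^ (Finset.univ.filter (· < x)).card)

/-- The particle-hole transformation of one species: the unitary `V` with
`(ann x)ᴴ V = ± V ann x`, where the sign is that of the sublattice of `x`. -/
def phole (A : Finset Λ) : Matrix (Finset Λ) (Finset Λ) ℂ :=
  of fun Y Z => if Z = Yᶜ then phSign A Z else 0

variable (A : Finset Λ)

lemma sgn_mul_self (x : Λ) : sgn A x * sgn A x = 1 := by
  unfold sgn; split_ifs <;> simp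

lemma phSign_mul_self (C : Finset Λ) : phSign A C * phSign A C = 1 := by
  rw [phSign, ← Finset.prod_mul_distrib]
  refine Finset.prod_eq_one fun x _ => ?_
  rw [mul_mul_mul_comm, sgn_mul_self, ← pow_add, ← two_mul, pow_mul]; simp

lemma star_phSign (C : Finset Λ) : star (phSign A C) = phSign A C := by
  simp only [phSign, RCLike.star_def, map_prod, map_mul, map_pow, map_neg, map_one]
  refine Finset.prod_congr rfl fun x _ => ?_
  congr 1
  unfold sgn; split_ifs <;> simp

lemma jwSign_mul_jwSign_compl (x : Λ) (C : Finset Λ) :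
    jwSign x C * jwSign x (insert x C)ᶜ = (-1) ^ (Finset.univ.filter (· < x)).card := by
  rw [jwSign, jwSign, ← pow_add, ← Finset.card_union_of_disjoint]
  · congr 2
    ext z
    simp only [Finset.mem_union, Finset.mem_filter, Finset.mem_compl, Finset.mem_insert,
      Finset.mem_univ, true_and, not_or]
    constructor
    · rintro (h | h)
      · exact h.2
      · exact h.2
    · intro h
      by_cases hz : z ∈ C
      · exact Or.inl ⟨hz, h⟩
      · exact Or.inr ⟨⟨h.ne, hz⟩, h⟩
  · rw [Finset.disjoint_left]
    intro z hz hz'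
    simp only [Finset.mem_filter, Finset.mem_compl, Finset.mem_insert, not_or] at hz hz'
    exact hz'.1.2 hz.1

lemma phole_apply (Y Z : Finset Λ) : phole A Y Z = if Z = Yᶜ then phSign A Z else 0 := rfl

lemma phole_mul_apply (M : Matrix (Finset Λ) (Finset Λ) ℂ) (Y Z : Finset Λ) :
    (phole A * M) Y Z = phSign A Yᶜ * M Yᶜ Z := by
  rw [mul_apply, Finset.sum_eq_single Yᶜ]
  · simp [phole_apply]
  · intro W _ hW; simp [phole_apply, hW]
  · simp

lemma mul_phole_transpose_apply (M : Matrix (Finset Λ) (Finset Λ) ℂ) (X Y : Finset Λ) :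
    (M * (phole A)ᵀ) X Y = M X Yᶜ * phSign A Yᶜ := by
  rw [mul_apply, Finset.sum_eq_single Yᶜ]
  · simp [phole_apply]
  · intro W _ hW; simp [phole_apply, hW]
  · simp

lemma phole_mul_transpose : phole A * (phole A)ᵀ = 1 := by
  ext X Y
  rw [mul_phole_transpose_apply, phole_apply, Matrix.one_apply]
  by_cases h : X = Y
  · subst h; simp [phSign_mul_self]
  · simp [h, Ne.symm h]

lemma phole_transpose_mul : (phole A)ᵀ * phole A = 1 :=
  mul_eq_one_comm.1 (phole_mul_transpose A)

lemma phole_transpose : (phole A)ᵀ = (phole A)ᴴ := by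
  ext X Y
  rw [transpose_apply, conjTranspose_apply, phole_apply]
  split_ifs
  · rw [star_phSign]
  · simp

lemma ann_conjTranspose_mul_phole (x : Λ) :
    (ann x)ᴴ * phole A = sgn A x • (phole A * ann x) := by
  ext Y Z
  rw [annT_mul_apply, Matrix.smul_apply, phole_mul_apply, ann_apply, phole_apply, smul_eq_mul]
  by_cases hx : x ∈ Y
  · have hxc : x ∉ Yᶜ := by simpa using hx
    have hins : (Y.erase x)ᶜ = insert x Yᶜ := by simp [Finset.compl_erase]
    have hY : Y.erase x = (insert x Yᶜ)ᶜ := by rw [← hins, compl_compl]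
    by_cases hZ : Z = insert x Yᶜ
    · subst hZ
      simp only [hx, hins, hxc, if_true, not_false_eq_true, and_self]
      rw [hY, phSign, Finset.prod_insert hxc, ← jwSign_mul_jwSign_compl x Yᶜ]
      change _ * (_ * (_ * _) * phSign A Yᶜ) = _
      linear_combination (sgn A x * phSign A Yᶜ * jwSign x Yᶜ)
        * jwSign_mul_self x (insert x Yᶜ)ᶜ
    · simp [hins, hZ]
  · simp [hx]

lemma ann_mul_phole (x : Λ) : ann x * phole A = sgn A x • (phole A * (ann x)ᴴ) := by
  calc ann x * phole A = phole A * (((phole A)ᵀ * ann x) * phole A) := by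
        rw [Matrix.mul_assoc, ← Matrix.mul_assoc (phole A), phole_mul_transpose, Matrix.one_mul]
    _ = _ := by
        have h := congrArg transpose (ann_conjTranspose_mul_phole A x)
        rw [transpose_mul, transpose_smul, transpose_mul, ann_conjTranspose_transpose,
          ann_transpose] at h
        rw [h, Matrix.smul_mul, Matrix.mul_assoc, phole_transpose_mul, Matrix.mul_one,
          Matrix.mul_smul]

lemma hop_mul_phole {t : Λ → Λ → ℝ} (ht : ∀ x y, t x y = t y x)
    (hbip : ∀ x y, t x y ≠ 0 → sgn A x * sgn A y = -1) : hop t * phole A = phole A * hop t := by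
  unfold hop
  conv_lhs => rw [Finset.sum_comm]
  rw [Matrix.sum_mul, Matrix.mul_sum]
  refine Finset.sum_congr rfl fun x _ => ?_
  rw [Matrix.sum_mul, Matrix.mul_sum]
  refine Finset.sum_congr rfl fun y _ => ?_
  by_cases h : t x y = 0
  · rw [ht y x]; simp [h]
  have hs := hbip x y h
  have hxy : y ≠ x := by
    rintro rfl
    rw [sgn_mul_self] at hs
    norm_num at hs
  rw [Matrix.smul_mul, Matrix.mul_smul, Matrix.mul_assoc, ann_mul_phole, Matrix.mul_smul,
    ← Matrix.mul_assoc, ann_conjTranspose_mul_phole, Matrix.smul_mul, smul_smul, smul_smul,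
    mul_assoc, hs, Matrix.mul_assoc, ann_mul_ann_conjTranspose, if_neg hxy.symm, ht y x]
  simp

lemma occ_mul_phole (x : Λ) : occ x * phole A = phole A * (1 - occ x) := by
  rw [← ann_conjTranspose_mul_ann, Matrix.mul_assoc, ann_mul_phole, Matrix.mul_smul,
    ← Matrix.mul_assoc, ann_conjTranspose_mul_phole, Matrix.smul_mul, smul_smul, sgn_mul_self,
    one_smul, Matrix.mul_assoc, ann_mul_ann_conjTranspose, if_pos rfl]

/-- The state represented by the matrix `W`: the entry at `(X, Z)` is, up to a sign, the amplitude
for up electrons in `X` and down holes in `Z`. -/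
def phState (W : Matrix (Finset Λ) (Finset Λ) ℂ) : State Λ := toState (W * (phole A)ᵀ)

lemma exists_eq_phState (Φ : State Λ) : ∃ W, Φ = phState A W := by
  refine ⟨(of fun X Y => Φ (X, Y)) * phole A, ?_⟩
  rw [phState, Matrix.mul_assoc, phole_mul_transpose, Matrix.mul_one]
  rfl

lemma phState_injective : Function.Injective (phState A) := by
  intro W W' h
  have h' := congrArg (· * phole A) (toState_injective h)
  simpa only [Matrix.mul_assoc, phole_transpose_mul, Matrix.mul_one] using h'

lemma phState_smul (a : ℂ) (W : Matrix (Finset Λ) (Finset Λ) ℂ) :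
    phState A (a • W) = a • phState A W := by
  rw [phState, Matrix.smul_mul, toState_smul]; rfl

lemma star_phState_dotProduct (W W' : Matrix (Finset Λ) (Finset Λ) ℂ) :
    star (phState A W) ⬝ᵥ phState A W' = (Wᴴ * W').trace := by
  rw [phState, phState, star_toState_dotProduct, conjTranspose_mul, phole_transpose,
    conjTranspose_conjTranspose, Matrix.mul_assoc, Matrix.trace_mul_comm, ← phole_transpose,
    Matrix.mul_assoc, Matrix.mul_assoc, phole_transpose_mul, Matrix.mul_one]

lemma phState_mem_sector_iff {n : ℕ} (hn : n ≤ Fintype.card Λ)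
    (W : Matrix (Finset Λ) (Finset Λ) ℂ) :
    phState A W ∈ sector n (Fintype.card Λ - n) ↔ SupportedOn (fun X => X.card = n) W := by
  have hs : ∀ C, phSign A C ≠ 0 := fun C h => by simpa [h] using phSign_mul_self A C
  rw [mem_sector_iff]
  simp only [phState, toState, mul_phole_transpose_apply, mul_ne_zero_iff, hs, ne_eq,
    not_false_eq_true, and_true, SupportedOn]
  constructor
  · intro h X Z hXZ
    have h2 := h X Zᶜ (by rwa [compl_compl])
    have := Finset.card_le_univ Z
    rw [Finset.card_compl] at h2
    exact ⟨h2.1, by omega⟩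
  · intro h X Y hXY
    have h2 := h X Yᶜ hXY
    have := Finset.card_le_univ Y
    rw [Finset.card_compl] at h2
    exact ⟨h2.1, by omega⟩

/-- The half-filled repulsive model is an attractive model of up electrons and down holes. -/
lemma hamiltonian_mulVec_phState {t : Λ → Λ → ℝ} (ht : ∀ x y, t x y = t y x)
    (hbip : ∀ x y, t x y ≠ 0 → sgn A x * sgn A y = -1) (U : ℝ) {n : ℕ}
    {W : Matrix (Finset Λ) (Finset Λ) ℂ} (hW : SupportedOn (fun X => X.card = n) W) :
    hamiltonian t (fun _ => U) *ᵥ phState A W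
      = phState A (reflOp (hop t) occ U W) + ((U * n : ℝ) : ℂ) • phState A W := by
  have hN : (∑ x, occ x) * W = (n : ℂ) • W := by
    ext X Z
    rw [sum_occ, diagonal_mul, Matrix.smul_apply, smul_eq_mul]
    by_cases h : W X Z = 0
    · simp [h]
    · rw [(hW X Z h).1]
  have e1 : (phole A)ᵀ * hop t = hop t * (phole A)ᵀ := by
    have h := congrArg transpose (hop_mul_phole A ht hbip)
    simpa only [transpose_mul, hop_transpose ht] using h
  have e2 : ∀ x, (phole A)ᵀ * occ x = (1 - occ x) * (phole A)ᵀ := by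
    intro x
    have h := congrArg transpose (occ_mul_phole A x)
    have hocc : (occ x)ᵀ = occ x := diagonal_transpose _
    simpa only [transpose_mul, transpose_sub, hocc, transpose_one] using h
  rw [phState, hamiltonian_mulVec_toState ht, phState, ← toState_smul, ← toState_add]
  congr 1
  simp only [Matrix.mul_assoc, e1, e2]
  simp only [← Matrix.mul_assoc, ← Matrix.sum_mul]
  simp only [← Matrix.smul_mul, ← Matrix.add_mul]
  congr 1
  rw [reflOp]
  simp only [Matrix.mul_sub, Matrix.mul_one, Finset.sum_sub_distrib, ← Matrix.sum_mul, hN,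
    smul_sub, smul_smul]
  push_cast
  abel

/-- The spin raising operator creates pairs of an up electron and a down hole. -/
lemma spinHop_up_down_mulVec_phState (W : Matrix (Finset Λ) (Finset Λ) ℂ) :
    spinHop 0 1 *ᵥ phState A W
      = phState A (∑ x, sgn A x • ((ann x)ᴴ * parity * W * ann x)) := by
  have e : ∀ x, (phole A)ᵀ * (ann x)ᵀ = sgn A x • (ann x * (phole A)ᵀ) := fun x => by
    rw [← transpose_mul, ann_mul_phole, transpose_smul, transpose_mul,
      ann_conjTranspose_transpose]
  simp only [spinHop, sum_mulVec, cDag_mul_c_up_down, phState, kronecker_mulVec_toState,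
    Matrix.sum_mul, toState_sum]
  refine Finset.sum_congr rfl fun x _ => ?_
  congr 1
  simp only [Matrix.mul_assoc, e, Matrix.mul_smul, Matrix.smul_mul]

end ParticleHole

/-! ### Connectivity of the configurations -/

section Connectivity

variable {Λ : Type*} [Fintype Λ] [LinearOrder Λ]

lemma image_swap_of_mem_of_notMem {x y : Λ} {X : Finset Λ} (hx : x ∈ X) (hy : y ∉ X) :
    X.image (Equiv.swap x y) = insert y (X.erase x) := by
  ext z
  simp only [Finset.mem_image, Finset.mem_insert, Finset.mem_erase]
  constructor
  · rintro ⟨w, hw, rfl⟩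
    rcases eq_or_ne w x with rfl | hwx
    · simp
    · have hwy : w ≠ y := fun h => hy (h ▸ hw)
      rw [Equiv.swap_apply_of_ne_of_ne hwx hwy]
      exact Or.inr ⟨hwx, hw⟩
  · rintro (rfl | ⟨hzx, hz⟩)
    · exact ⟨x, hx, by simp⟩
    · exact ⟨z, hz, Equiv.swap_apply_of_ne_of_ne hzx fun h => hy (h ▸ hz)⟩

lemma image_swap_of_mem_iff {x y : Λ} {X : Finset Λ} (h : x ∈ X ↔ y ∈ X) :
    X.image (Equiv.swap x y) = X := by
  apply Finset.eq_of_subset_of_card_le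
  · intro z hz
    obtain ⟨w, hw, rfl⟩ := Finset.mem_image.1 hz
    rw [Equiv.swap_apply_def]
    split_ifs with h1 h2
    · subst h1; exact h.1 hw
    · subst h2; exact h.2 hw
    · exact hw
  · rw [Finset.card_image_of_injective _ (Equiv.injective _)]

/-- A property of sets of sites that is preserved when a particle hops along an edge of a connected
graph only depends on the number of particles: it is preserved by the transpositions of edges, and
so by all transpositions. -/
lemma of_card_eq_of_hop {t : Λ → Λ → ℝ} (ht : ∀ x y, t x y = t y x) (hconn : IsConnected t)
    {P : Finset Λ → Prop}
    (hP : ∀ X x y, t x y ≠ 0 → x ∈ X → y ∉ X → P X → P (insert y (X.erase x)))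
    {X Y : Finset Λ} (hXY : X.card = Y.card) (hX : P X) : P Y := by
  have hedge : ∀ x y, t x y ≠ 0 → ∀ X, P X → P (X.image (Equiv.swap x y)) := by
    intro x y hxy X hX
    by_cases hx : x ∈ X <;> by_cases hy : y ∈ X
    · rwa [image_swap_of_mem_iff (by simp [hx, hy])]
    · rw [image_swap_of_mem_of_notMem hx hy]
      exact hP X x y hxy hx hy hX
    · rw [Equiv.swap_comm, image_swap_of_mem_of_notMem hy hx]
      exact hP X y x (by rwa [ht]) hy hx hX
    · rwa [image_swap_of_mem_iff (by simp [hx, hy])]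
  have hswap : ∀ x y, ∀ X, P X → P (X.image (Equiv.swap x y)) := by
    intro x y
    induction hconn x y with
    | refl => intro X hX; simpa using hX
    | @tail b c _ hbc ih =>
      intro X hX
      rcases eq_or_ne x b with rfl | hxb
      · exact hedge x c hbc X hX
      rcases eq_or_ne x c with rfl | hxc
      · simpa using hX
      have h := hedge b c hbc _ (ih _ (hedge b c hbc _ hX))
      rw [Finset.image_image, Finset.image_image] at h
      rwa [Equiv.swap_comm x c, ← Equiv.swap_mul_swap_mul_swap hxb hxc]
  suffices key : ∀ k, ∀ X : Finset Λ, X.card = Y.card → (Y \ X).card = k → P X → P Y from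
    key _ X hXY rfl hX
  intro k
  induction k with
  | zero =>
    intro X hXY h hX
    have hsub : Y ⊆ X := by rwa [Finset.card_eq_zero, Finset.sdiff_eq_empty_iff_subset] at h
    rwa [Finset.eq_of_subset_of_card_le hsub hXY.le]
  | succ k ih =>
    intro X hXY h hX
    obtain ⟨y, hy⟩ : (Y \ X).Nonempty := by rw [← Finset.card_pos]; omega
    obtain ⟨x, hx⟩ : (X \ Y).Nonempty := by
      rw [← Finset.card_pos, Finset.card_sdiff_comm hXY]; omega
    rw [Finset.mem_sdiff] at hx hy
    refine ih (X.image (Equiv.swap x y)) ?_ ?_ (hswap x y X hX)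
    · rw [Finset.card_image_of_injective _ (Equiv.injective _), hXY]
    · rw [image_swap_of_mem_of_notMem hx.1 hy.2]
      have hE : Y \ insert y (X.erase x) = (Y \ X).erase y := by
        ext z
        simp only [Finset.mem_sdiff, Finset.mem_insert, Finset.mem_erase]
        constructor
        · rintro ⟨hz, hz'⟩
          push Not at hz'
          refine ⟨hz'.1, hz, fun hzX => hz'.2 (fun h => hx.2 (h ▸ hz)) hzX⟩
        · rintro ⟨hzy, hz, hzX⟩
          exact ⟨hz, by tauto⟩
      rw [hE, Finset.card_erase_of_mem (by simpa using hy), h]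
      rfl

lemma hop_apply_of_hop (t : Λ → Λ → ℝ) {x y : Λ} {X : Finset Λ} (hx : x ∈ X) (hy : y ∉ X) :
    hop t (insert y (X.erase x)) X = t y x * (jwSign y (X.erase x) * jwSign x (X.erase x)) := by
  have hyx : y ≠ x := fun h => hy (h ▸ hx)
  have hye : y ∉ X.erase x := fun h => hy (Finset.mem_of_mem_erase h)
  have entry : ∀ z w, ((ann z)ᴴ * ann w) (insert y (X.erase x)) X
      = if z = y ∧ w = x then jwSign y (X.erase x) * jwSign x (X.erase x) else 0 := by
    intro z w
    rw [annT_mul_apply, ann_apply]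
    split_ifs with h1 h2 h3 h3 h3
    · rw [h3.1, h3.2, Finset.erase_insert hye]
    · exfalso
      have hzy : z = y := by
        by_contra hne
        have hmem : y ∈ X := by
          rw [h2.2]
          exact Finset.mem_insert_of_mem
            (Finset.mem_erase.2 ⟨Ne.symm hne, Finset.mem_insert_self _ _⟩)
        exact hy hmem
      subst hzy
      rw [Finset.erase_insert hye] at h2
      have hxw : x ∈ insert w (X.erase x) := h2.2 ▸ hx
      rcases Finset.mem_insert.1 hxw with h | h
      · exact h3 ⟨rfl, h.symm⟩
      · simp at h
    · exfalso
      apply h2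
      rw [h3.1, h3.2, Finset.erase_insert hye]
      exact ⟨by simp, (Finset.insert_erase hx).symm⟩
    · simp
    · exact absurd (by rw [h3.1]; exact Finset.mem_insert_self _ _) h1
    · rfl
  rw [hop, Matrix.sum_apply, Finset.sum_eq_single y]
  · rw [Matrix.sum_apply, Finset.sum_eq_single x]
    · simp [entry]
    · intro w _ hw; simp [entry, hw]
    · simp
  · intro z _ hz
    rw [Matrix.sum_apply]
    exact Finset.sum_eq_zero fun w _ => by simp [entry, hz]
  · simp

/-- A subspace invariant under the occupation numbers contains the components of its vectors along
the basis vectors. -/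
lemma single_mem_of_occ_invariant {K : Submodule ℂ (Finset Λ → ℂ)}
    (hK : ∀ x, ∀ v ∈ K, occ x *ᵥ v ∈ K) {v : Finset Λ → ℂ} (hv : v ∈ K) {X : Finset Λ}
    (hX : v X ≠ 0) : Pi.single X 1 ∈ K := by
  have key : ∀ s : Finset Λ,
      (fun Z => if ∀ z ∈ s, (z ∈ Z ↔ z ∈ X) then v Z else 0) ∈ K := by
    intro s
    induction s using Finset.induction_on with
    | empty => simpa using hv
    | insert a s _ ih =>
      set f : Finset Λ → ℂ := fun Z => if ∀ z ∈ s, (z ∈ Z ↔ z ∈ X) then v Z else 0 with hf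
      by_cases ha : a ∈ X
      · convert! hK a f ih using 1
        ext Z
        rw [occ, mulVec_diagonal, hf]
        by_cases haZ : a ∈ Z <;> simp [ha, haZ]
      · convert! K.sub_mem ih (hK a f ih) using 1
        ext Z
        rw [Pi.sub_apply, occ, mulVec_diagonal, hf]
        by_cases haZ : a ∈ Z <;> simp [ha, haZ]
  convert! K.smul_mem (v X)⁻¹ (key Finset.univ) using 1
  ext Z
  by_cases h : Z = X
  · subst h; simp [hX]
  · have h' : ¬ ∀ z, (z ∈ Z ↔ z ∈ X) := fun h' => h (Finset.ext h')
    simp [h, h']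

/-- On a connected lattice the hopping Hamiltonian and the occupation numbers act irreducibly on
the states of `n` particles of one species. -/
lemma single_mem_of_hop_occ_invariant {t : Λ → Λ → ℝ} (ht : ∀ x y, t x y = t y x)
    (hconn : IsConnected t) (n : ℕ) (K : Submodule ℂ (Finset Λ → ℂ))
    (hT : ∀ v ∈ K, hop t *ᵥ v ∈ K) (hD : ∀ x, ∀ v ∈ K, occ x *ᵥ v ∈ K)
    (v : Finset Λ → ℂ) (hv : v ∈ K) (X : Finset Λ) (hX : X.card = n) (hvX : v X ≠ 0)
    (Y : Finset Λ) (hY : Y.card = n) : Pi.single Y 1 ∈ K := by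
  refine of_card_eq_of_hop (P := fun X => Pi.single X 1 ∈ K) ht hconn ?_ (hX.trans hY.symm)
    (single_mem_of_occ_invariant hD hv hvX)
  intro Z x y hxy hx hy hZ
  refine single_mem_of_occ_invariant hD (hT _ hZ) ?_
  rw [mulVec_single_one]
  change hop t (insert y (Z.erase x)) Z ≠ 0
  have hs : ∀ (a : Λ) (C : Finset Λ), jwSign a C ≠ 0 := fun a C h => by
    simpa [h] using jwSign_mul_self a C
  rw [hop_apply_of_hop t hx hy, ht]
  exact mul_ne_zero (by exact_mod_cast hxy) (mul_ne_zero (hs _ _) (hs _ _))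

end Connectivity

/-! ### A reference state of known spin -/

noncomputable section Reference

variable {Λ : Type*} [Fintype Λ] [LinearOrder Λ]

/-- The diagonal weights `a! b!` on the sets of `n` sites, `a` of them in `A` and `b` not in `A`. -/
def refWeight (A : Finset Λ) (n : ℕ) (X : Finset Λ) : ℝ :=
  if X.card = n then ((X ∩ A).card.factorial * (X \ A).card.factorial : ℕ) else 0

/-- The reference state: a superposition of states in which every site is singly occupied. -/
def refState (A : Finset Λ) (n : ℕ) : State Λ :=
  phState A (diagonal fun X => (refWeight A n X : ℂ))

lemma refWeight_pos (A : Finset Λ) {n : ℕ} {X : Finset Λ} (hX : X.card = n) :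
    0 < refWeight A n X := by
  rw [refWeight, if_pos hX]
  exact_mod_cast Nat.mul_pos (Nat.factorial_pos _) (Nat.factorial_pos _)

lemma refWeight_of_card_ne (A : Finset Λ) {n : ℕ} {X : Finset Λ} (hX : X.card ≠ n) :
    refWeight A n X = 0 := if_neg hX

/-- Removing a site of `A` from a set with `a` sites in `A` and `b` others, in all possible ways,
gives the total weight `a (a - 1)! b! = a! b!`; so does removing a site outside `A`. -/
lemma sum_sgn_mul_refWeight_erase {A : Finset Λ} {n : ℕ} (hA : A.card ≤ n) (hA' : Aᶜ.card ≤ n)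
    (X : Finset Λ) : ∑ x ∈ X, sgn A x * (refWeight A n (X.erase x) : ℂ) = 0 := by
  by_cases hX : X.card = n + 1
  swap
  · refine Finset.sum_eq_zero fun x hx => ?_
    have hpos : 0 < X.card := Finset.card_pos.2 ⟨x, hx⟩
    rw [refWeight_of_card_ne, Complex.ofReal_zero, mul_zero]
    rw [Finset.card_erase_of_mem hx]
    omega
  set a := (X ∩ A).card with ha
  set b := (X \ A).card with hb
  have hab : a + b = n + 1 := by rw [ha, hb, Finset.card_inter_add_card_sdiff, hX]
  have hXA : a ≤ A.card := Finset.card_le_card Finset.inter_subset_right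
  have hXB : b ≤ Aᶜ.card := Finset.card_le_card fun z hz => by
    simpa using (Finset.mem_sdiff.1 hz).2
  have hn : ∀ x ∈ X, (X.erase x).card = n := fun x hx => by
    rw [Finset.card_erase_of_mem hx, hX]; rfl
  have h1 : ∀ x ∈ X ∩ A, sgn A x * (refWeight A n (X.erase x) : ℂ)
      = (((a - 1).factorial * b.factorial : ℕ) : ℂ) := by
    intro x hx
    have hx' := Finset.mem_inter.1 hx
    have e1 : (X.erase x ∩ A).card = a - 1 := by
      rw [Finset.erase_inter, Finset.card_erase_of_mem hx]
    have e2 : X.erase x \ A = X \ A := by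
      rw [Finset.erase_sdiff_comm, Finset.erase_eq_of_notMem (by simp [hx'.2])]
    rw [refWeight, if_pos (hn x hx'.1), e1, e2, sgn, if_pos hx'.2, one_mul]
    push_cast; rfl
  have h2 : ∀ x ∈ X \ A, sgn A x * (refWeight A n (X.erase x) : ℂ)
      = -((a.factorial * (b - 1).factorial : ℕ) : ℂ) := by
    intro x hx
    have hx' := Finset.mem_sdiff.1 hx
    have e1 : X.erase x ∩ A = X ∩ A := by
      rw [Finset.erase_inter, Finset.erase_eq_of_notMem (by simp [hx'.2])]
    have e2 : (X.erase x \ A).card = b - 1 := by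
      rw [Finset.erase_sdiff_comm, Finset.card_erase_of_mem hx]
    rw [refWeight, if_pos (hn x hx'.1), e1, e2, sgn, if_neg hx'.2]
    push_cast; ring
  rw [← Finset.sum_inter_add_sum_sdiff X A, Finset.sum_congr rfl h1, Finset.sum_congr rfl h2,
    Finset.sum_const, Finset.sum_const, ← ha, ← hb]
  -- `n` is at least the size of each sublattice, so that `a` and `b` are positive.
  obtain ⟨a', ha'⟩ : ∃ a', a = a' + 1 := ⟨a - 1, by omega⟩
  obtain ⟨b', hb'⟩ : ∃ b', b = b' + 1 := ⟨b - 1, by omega⟩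
  rw [ha', hb']
  simp only [Nat.add_sub_cancel, Nat.factorial_succ]
  push_cast
  simp only [nsmul_eq_mul]
  push_cast
  ring

/-- The reference state is a highest weight vector of the spin algebra. -/
lemma spinHop_up_down_mulVec_refState {A : Finset Λ} {n : ℕ} (hA : A.card ≤ n)
    (hA' : Aᶜ.card ≤ n) : spinHop 0 1 *ᵥ refState A n = 0 := by
  rw [refState, spinHop_up_down_mulVec_phState]
  have hz : (∑ x, sgn A x • ((ann x)ᴴ * parity * (diagonal fun X => (refWeight A n X : ℂ))
      * ann x)) = 0 := by
    ext X Z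
    have entry : ∀ x, (sgn A x • ((ann x)ᴴ * parity *
        (diagonal fun X => (refWeight A n X : ℂ)) * ann x) :
          Matrix (Finset Λ) (Finset Λ) ℂ) X Z
        = if x ∈ X then (if Z = X then (-1) ^ (X.card - 1)
            * (sgn A x * (refWeight A n (X.erase x) : ℂ)) else 0) else 0 := by
      intro x
      rw [Matrix.smul_apply, Matrix.mul_assoc, Matrix.mul_assoc, annT_mul_apply]
      split_ifs with hx hZ
      · subst hZ
        rw [parity, diagonal_mul, diagonal_mul, ann_apply, if_pos ⟨by simp, by simp [hx]⟩,
          Finset.card_erase_of_mem hx, smul_eq_mul]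
        linear_combination (sgn A x * (-1) ^ (Z.card - 1) * (refWeight A n (Z.erase x) : ℂ))
          * jwSign_mul_self x (Z.erase x)
      · rw [parity, diagonal_mul, diagonal_mul, ann_apply, if_neg]
        · simp
        · rintro ⟨-, h⟩
          exact hZ (by rw [h, Finset.insert_erase hx])
      · simp
    rw [Matrix.sum_apply, Finset.sum_congr rfl fun x _ => entry x, Finset.sum_ite_mem,
      Finset.univ_inter]
    split_ifs with hZ
    · rw [← Finset.mul_sum, sum_sgn_mul_refWeight_erase hA hA', mul_zero]; rfl
    · simp
  rw [hz]
  ext p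
  simp [phState, toState]

lemma refState_mem_sector (A : Finset Λ) {n : ℕ} (hn : n ≤ Fintype.card Λ) :
    refState A n ∈ sector n (Fintype.card Λ - n) := by
  rw [refState, phState_mem_sector_iff A hn]
  intro X Y hXY
  by_cases h : X = Y
  · subst h
    rw [diagonal_apply_eq] at hXY
    have : X.card = n := by
      by_contra hc
      exact hXY (by rw [refWeight_of_card_ne A hc, Complex.ofReal_zero])
    exact ⟨this, this⟩
  · simp [h] at hXY

lemma star_refState_dotProduct (A : Finset Λ) (n : ℕ) (W : Matrix (Finset Λ) (Finset Λ) ℂ) :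
    star (refState A n) ⬝ᵥ phState A W = ∑ X, (refWeight A n X : ℂ) * W X X := by
  rw [refState, star_phState_dotProduct, diagonal_conjTranspose, trace]
  refine Finset.sum_congr rfl fun X _ => ?_
  rw [diag_apply, diagonal_mul, Pi.star_apply, RCLike.star_def, Complex.conj_ofReal]

lemma refState_ne_zero (A : Finset Λ) {n : ℕ} (hn : n ≤ Fintype.card Λ) : refState A n ≠ 0 := by
  intro h
  obtain ⟨X, -, hX⟩ := Finset.exists_subset_card_eq (s := (Finset.univ : Finset Λ)) (n := n)
    (by simpa using hn)
  have h0 : phState A (0 : Matrix (Finset Λ) (Finset Λ) ℂ) = 0 := by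
    ext p; simp [phState, toState]
  have hd := congrFun (congrFun (phState_injective A (h.trans h0.symm)) X) X
  rw [diagonal_apply_eq, Matrix.zero_apply] at hd
  exact (refWeight_pos A hX).ne' (by exact_mod_cast hd)

end Reference

/-! ### Spin multiplets -/

section Multiplets

variable {Λ : Type*} [Fintype Λ] [LinearOrder Λ]

lemma star_spinHop_mulVec_dotProduct (σ τ : Fin 2) (Φ Ψ : State Λ) :
    star (spinHop σ τ *ᵥ Φ) ⬝ᵥ Ψ = star Φ ⬝ᵥ spinHop τ σ *ᵥ Ψ := by
  rw [star_mulVec, spinHop_conjTranspose, dotProduct_mulVec]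

lemma totalSpinSq_mulVec_of_sub {Φ : State Λ} {μ : ℝ}
    (hΦ : (spinHop 0 0 - spinHop 1 1) *ᵥ Φ = ((2 * μ : ℝ) : ℂ) • Φ) :
    totalSpinSq *ᵥ Φ
      = spinHop 1 0 *ᵥ (spinHop 0 1 *ᵥ Φ) + ((μ * (μ + 1) : ℝ) : ℂ) • Φ := by
  rw [totalSpinSq_eq, add_mulVec, add_mulVec, smul_mulVec, smul_mulVec, ← mulVec_mulVec,
    ← mulVec_mulVec, hΦ, mulVec_smul, hΦ, add_assoc]
  congr 1
  push_cast
  module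

lemma sub_mulVec_of_mem_sector {n m : ℕ} {Φ : State Λ} (hΦ : Φ ∈ sector n m) {μ : ℝ}
    (hμ : (n : ℝ) - m = 2 * μ) :
    (spinHop 0 0 - spinHop 1 1) *ᵥ Φ = ((2 * μ : ℝ) : ℂ) • Φ := by
  rw [mem_sector] at hΦ
  rw [sub_mulVec, hΦ.1, hΦ.2, ← sub_smul, ← hμ]
  push_cast; rfl

lemma totalNum_mulVec_of_mem_sector {n m : ℕ} {Φ : State Λ} (hΦ : Φ ∈ sector n m) :
    totalNum *ᵥ Φ = ((n + m : ℕ) : ℂ) • Φ := by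
  rw [mem_sector] at hΦ
  rw [totalNum_eq, add_mulVec, hΦ.1, hΦ.2, ← add_smul]
  push_cast; rfl

lemma mem_spinSpace_of_mem_sector {n m : ℕ} {Φ : State Λ} (hΦ : Φ ∈ sector n m) {S : ℝ}
    (hS : (n : ℝ) - m = 2 * S) (h : spinHop 1 0 *ᵥ (spinHop 0 1 *ᵥ Φ) = 0) :
    Φ ∈ spinSpace (n + m) S := by
  rw [mem_spinSpace]
  refine ⟨totalNum_mulVec_of_mem_sector hΦ, ?_⟩
  rw [totalSpinSq_mulVec_of_sub (sub_mulVec_of_mem_sector hΦ hS), h, zero_add]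

/-- An operator that commutes with the number of up electrons commutes with the projections on
the states with a given number of up electrons. -/
lemma commute_diagonal_card_eq {H : Op Λ} (hH : Commute H (spinHop 0 0)) (k : ℕ) :
    Commute H (diagonal fun p : Config Λ => if p.1.card = k then (1 : ℂ) else 0) := by
  rw [spinHop_up_eq_diagonal, commute_iff_eq] at hH
  rw [commute_iff_eq]
  ext p q
  have h := congrFun (congrFun hH p) q
  rw [mul_diagonal, diagonal_mul, mul_comm] at h
  rw [mul_diagonal, diagonal_mul, mul_comm]
  by_cases hpq : H p q = 0
  · simp [hpq]
  · have h' : q.1.card = p.1.card := by exact_mod_cast mul_right_cancel₀ hpq h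
    rw [h']

/-- A spin multiplet of energy eigenstates with total spin `S > 0` contains a state whose third
spin component is `S - 1`: lower the state with the largest third component. -/
lemma exists_lowered_eigenstate {H : Op Λ} (hH : ∀ μ ν, Commute H (spinHop μ ν)) {Ne : ℕ}
    {S : ℝ} (hS : 0 < S) {E : ℂ} {Φ : State Λ} (hΦ0 : Φ ≠ 0) (hΦS : Φ ∈ spinSpace Ne S)
    (hΦE : H *ᵥ Φ = E • Φ) :
    ∃ Ψ : State Λ, Ψ ≠ 0 ∧ Ψ ∈ spinSpace Ne S ∧ H *ᵥ Ψ = E • Ψ ∧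
      spinHop 0 0 *ᵥ Ψ = ((Ne / 2 + S - 1 : ℝ) : ℂ) • Ψ := by
  let P : ℕ → Prop := fun k => ∃ Ψ : State Λ, Ψ ≠ 0 ∧ Ψ ∈ spinSpace Ne S ∧ H *ᵥ Ψ = E • Ψ ∧
    spinHop 0 0 *ᵥ Ψ = (k : ℂ) • Ψ
  have hbound : ∀ k, P k → k ≤ Fintype.card Λ := by
    rintro k ⟨Ψ, hΨ0, -, -, hk⟩
    obtain ⟨p, hp⟩ := Function.ne_iff.1 hΨ0
    have h := congrFun hk p
    rw [spinHop_up_mulVec_apply, Pi.smul_apply, smul_eq_mul] at h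
    have h' : p.1.card = k := by exact_mod_cast mul_right_cancel₀ hp h
    rw [← h']
    exact Finset.card_le_univ _
  have hex : ∃ k, P k := by
    obtain ⟨p, hp⟩ := Function.ne_iff.1 hΦ0
    set D : Op Λ := diagonal fun q : Config Λ => if q.1.card = p.1.card then (1 : ℂ) else 0
      with hD
    refine ⟨p.1.card, D *ᵥ Φ, ?_, ?_, ?_, ?_⟩
    · intro h
      have h' := congrFun h p
      rw [hD, mulVec_diagonal, if_pos rfl, one_mul] at h'
      exact hp h'
    · rw [mem_spinSpace] at hΦS ⊢
      rw [mulVec_comm_of_commute (commute_diagonal_card_eq (totalNum_commute_spinHop 0 0) _),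
        mulVec_comm_of_commute (commute_diagonal_card_eq (totalSpinSq_commute_spinHop 0 0) _),
        hΦS.1, hΦS.2, mulVec_smul, mulVec_smul]
      exact ⟨rfl, rfl⟩
    · rw [mulVec_comm_of_commute (commute_diagonal_card_eq (hH 0 0) _), hΦE, mulVec_smul]
    · ext q
      rw [spinHop_up_mulVec_apply, Pi.smul_apply, smul_eq_mul, hD, mulVec_diagonal]
      split_ifs with h
      · rw [h]
      · simp
  obtain ⟨k, ⟨Ψ, hΨ0, hΨS, hΨE, hΨk⟩, hmax⟩ : ∃ k, P k ∧ ∀ l, P l → l ≤ k := by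
    classical
    obtain ⟨k₀, hk₀⟩ := hex
    exact ⟨Nat.findGreatest P (Fintype.card Λ), Nat.findGreatest_spec (hbound _ hk₀) hk₀,
      fun l hl => Nat.le_findGreatest (hbound _ hl) hl⟩
  have hspin : ∀ σ τ, spinHop σ τ *ᵥ Ψ ∈ spinSpace Ne S := by
    intro σ τ
    rw [mem_spinSpace] at hΨS ⊢
    rw [mulVec_comm_of_commute (totalNum_commute_spinHop σ τ),
      mulVec_comm_of_commute (totalSpinSq_commute_spinHop σ τ), hΨS.1, hΨS.2, mulVec_smul,
      mulVec_smul]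
    exact ⟨rfl, rfl⟩
  have hener : ∀ σ τ, H *ᵥ (spinHop σ τ *ᵥ Ψ) = E • (spinHop σ τ *ᵥ Ψ) := by
    intro σ τ
    rw [mulVec_comm_of_commute (hH σ τ), hΨE, mulVec_smul]
  have hraise : spinHop 0 0 *ᵥ (spinHop 0 1 *ᵥ Ψ) = ((k + 1 : ℕ) : ℂ) • (spinHop 0 1 *ᵥ Ψ) := by
    have h := spinHop_mul_spinHop (Λ := Λ) 0 0 0 1
    simp only [if_true, zero_ne_one, if_false, sub_zero] at h
    rw [mulVec_mulVec, sub_eq_iff_eq_add.1 h, add_mulVec, ← mulVec_mulVec, hΨk, mulVec_smul]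
    push_cast
    module
  have hlower : spinHop 0 0 *ᵥ (spinHop 1 0 *ᵥ Ψ) = ((k : ℂ) - 1) • (spinHop 1 0 *ᵥ Ψ) := by
    have h := spinHop_mul_spinHop (Λ := Λ) 0 0 1 0
    simp only [if_true, one_ne_zero, if_false, zero_sub] at h
    rw [mulVec_mulVec, sub_eq_iff_eq_add.1 h, add_mulVec, ← mulVec_mulVec, hΨk, mulVec_smul,
      neg_mulVec]
    module
  have htop : spinHop 0 1 *ᵥ Ψ = 0 := by
    by_contra h
    have := hmax (k + 1) ⟨_, h, hspin 0 1, hener 0 1, hraise⟩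
    omega
  rw [mem_spinSpace] at hΨS
  set μ : ℝ := k - Ne / 2 with hμ
  have hsub : (spinHop 0 0 - spinHop 1 1) *ᵥ Ψ = ((2 * μ : ℝ) : ℂ) • Ψ := by
    have h := hΨS.1
    rw [totalNum_eq, add_mulVec, hΨk] at h
    rw [sub_mulVec, hΨk, eq_sub_of_add_eq' h, hμ]
    push_cast
    module
  have hcas : μ * (μ + 1) = S * (S + 1) := by
    have h := totalSpinSq_mulVec_of_sub hsub
    rw [htop, mulVec_zero, zero_add, hΨS.2] at h
    exact_mod_cast (smul_left_injective ℂ hΨ0 h).symm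
  have hnorm : star (spinHop 1 0 *ᵥ Ψ) ⬝ᵥ (spinHop 1 0 *ᵥ Ψ)
      = ((2 * μ : ℝ) : ℂ) * (star Ψ ⬝ᵥ Ψ) := by
    rw [star_spinHop_mulVec_dotProduct, mulVec_mulVec, raise_mul_lower, add_mulVec, hsub,
      ← mulVec_mulVec, htop, mulVec_zero, zero_add, dotProduct_smul, smul_eq_mul]
  have hnorm' := congrArg Complex.re hnorm
  rw [Complex.re_ofReal_mul] at hnorm'
  have hpos := star_dotProduct_self_re_pos hΨ0
  have hμ0 : 0 ≤ μ := by
    have h := star_dotProduct_self_re_nonneg (spinHop 1 0 *ᵥ Ψ)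
    rw [hnorm'] at h
    have := nonneg_of_mul_nonneg_left h hpos
    linarith
  have hμS : μ = S := by
    have h : (μ - S) * (μ + S + 1) = 0 := by linear_combination hcas
    rcases mul_eq_zero.1 h with h | h <;> linarith
  refine ⟨spinHop 1 0 *ᵥ Ψ, ?_, hspin 1 0, hener 1 0, ?_⟩
  · intro h
    rw [h] at hnorm'
    simp only [dotProduct_zero, Complex.zero_re] at hnorm'
    have : 0 < 2 * μ * (star Ψ ⬝ᵥ Ψ).re := by rw [hμS]; positivity
    linarith
  · rw [hlower, ← hμS, hμ]
    push_cast
    congr 1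
    ring

end Multiplets

/-! ### Ground states of the sectors -/

section Ground

variable {Λ : Type*} [Fintype Λ] [LinearOrder Λ]

/-- A ground state of a sector is not orthogonal to the reference state, unless it is zero. -/
lemma eq_zero_of_sector_ground {t : Λ → Λ → ℝ} (ht : ∀ x y, t x y = t y x)
    (hconn : IsConnected t) {A : Finset Λ} (hbip : ∀ x y, t x y ≠ 0 → sgn A x * sgn A y = -1)
    {U : ℝ} (hU : 0 < U) {n : ℕ} (hn : n ≤ Fintype.card Λ) {E : ℝ}
    (hE : ∀ Ψ ∈ sector n (Fintype.card Λ - n), star Ψ ⬝ᵥ Ψ = 1 →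
      E ≤ (star Ψ ⬝ᵥ hamiltonian t (fun _ => U) *ᵥ Ψ).re)
    {Φ : State Λ} (hΦ : Φ ∈ sector n (Fintype.card Λ - n))
    (hΦE : hamiltonian t (fun _ => U) *ᵥ Φ = (E : ℂ) • Φ)
    (horth : star (refState A n) ⬝ᵥ Φ = 0) : Φ = 0 := by
  have hreduce : ∀ W, SupportedOn (fun X : Finset Λ => X.card = n) W →
      hamiltonian t (fun _ => U) *ᵥ phState A W = (E : ℂ) • phState A W →
      reflOp (hop t) occ U W = ((E - U * n : ℝ) : ℂ) • W := by
    intro W hW h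
    rw [hamiltonian_mulVec_phState A ht hbip U hW] at h
    apply phState_injective A
    rw [phState_smul, eq_sub_of_add_eq h]
    push_cast
    module
  have hmin : ∀ W, SupportedOn (fun X : Finset Λ => X.card = n) W →
      (Wᴴ * reflOp (hop t) occ U W).trace.re ≤ (E - U * n) * (Wᴴ * W).trace.re →
      reflOp (hop t) occ U W = ((E - U * n : ℝ) : ℂ) • W := by
    intro W hW h
    refine hreduce W hW (mulVec_eq_smul_of_energy_le (hamiltonian_isHermitian ht _)
      (fun v hv => mulVec_mem_sector (hamiltonian_commute_spinHop t _) hv) hE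
      ((phState_mem_sector_iff A hn W).2 hW) ?_)
    rw [hamiltonian_mulVec_phState A ht hbip U hW, dotProduct_add, dotProduct_smul,
      star_phState_dotProduct, star_phState_dotProduct, Complex.add_re, smul_eq_mul,
      Complex.re_ofReal_mul]
    linarith
  obtain ⟨W, rfl⟩ := exists_eq_phState A Φ
  have hW := (phState_mem_sector_iff A hn W).1 hΦ
  have hW0 : W = 0 := eq_zero_of_ground_of_trace_eq_zero (hop_isHermitian ht) occ_isHermitian hU
    (fun K hT hD v hv X hX hvX Y hY =>
      single_mem_of_hop_occ_invariant ht hconn n K hT hD v hv X hX hvX Y hY)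
    hmin (fun X hX => refWeight_pos A hX) hW (hreduce W hW hΦE)
    (by rw [← star_refState_dotProduct, horth])
  rw [hW0]
  ext p
  simp [phState, toState]

/-- A ground state of a sector has the total spin of the reference state: `S⁻ S⁺` maps it to
another ground state, which is orthogonal to the reference state and hence zero. -/
lemma spinHop_mulVec_eq_zero_of_sector_ground {t : Λ → Λ → ℝ} (ht : ∀ x y, t x y = t y x)
    (hconn : IsConnected t) {A : Finset Λ} (hbip : ∀ x y, t x y ≠ 0 → sgn A x * sgn A y = -1)
    {U : ℝ} (hU : 0 < U) {n : ℕ} (hn : n ≤ Fintype.card Λ) (hA : A.card ≤ n)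
    (hA' : Aᶜ.card ≤ n) {E : ℝ}
    (hE : ∀ Ψ ∈ sector n (Fintype.card Λ - n), star Ψ ⬝ᵥ Ψ = 1 →
      E ≤ (star Ψ ⬝ᵥ hamiltonian t (fun _ => U) *ᵥ Ψ).re)
    {Φ : State Λ} (hΦ : Φ ∈ sector n (Fintype.card Λ - n))
    (hΦE : hamiltonian t (fun _ => U) *ᵥ Φ = (E : ℂ) • Φ) :
    spinHop 1 0 *ᵥ (spinHop 0 1 *ᵥ Φ) = 0 := by
  have hH := hamiltonian_commute_spinHop t (fun _ => U)
  have hcomm : ∀ σ, Commute (spinHop σ σ : Op Λ) (spinHop 1 0 * spinHop 0 1) := by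
    intro σ
    have h1 := spinHop_mul_spinHop (Λ := Λ) σ σ 1 0
    have h2 := spinHop_mul_spinHop (Λ := Λ) σ σ 0 1
    rw [commute_iff_eq, ← sub_eq_zero]
    have e : spinHop σ σ * (spinHop 1 0 * spinHop 0 1) - spinHop 1 0 * spinHop 0 1 * spinHop σ σ
        = (spinHop σ σ * spinHop 1 0 - spinHop 1 0 * spinHop σ σ) * spinHop 0 1
          + spinHop 1 0 * (spinHop σ σ * spinHop 0 1 - spinHop 0 1 * spinHop σ σ : Op Λ) := by
      noncomm_ring
    rw [e, h1, h2]
    fin_cases σ <;> simp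
  apply eq_zero_of_sector_ground ht hconn hbip hU hn hE
  · rw [mem_sector] at hΦ ⊢
    rw [mulVec_mulVec _ (spinHop 1 0), mulVec_comm_of_commute (hcomm 0),
      mulVec_comm_of_commute (hcomm 1), hΦ.1, hΦ.2, mulVec_smul, mulVec_smul]
    exact ⟨rfl, rfl⟩
  · rw [mulVec_mulVec _ (spinHop 1 0),
      mulVec_comm_of_commute ((hH 1 0).mul_right (hH 0 1)), hΦE, mulVec_smul]
  · rw [← star_spinHop_mulVec_dotProduct, spinHop_up_down_mulVec_refState hA hA']
    simp

/-- The lowest energy of a nonempty spin sector is attained, at an eigenstate. -/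
lemma exists_isLeast_energies {t : Λ → Λ → ℝ} (ht : ∀ x y, t x y = t y x) (U : Λ → ℝ) {Ne : ℕ}
    {S : ℝ} (hne : ∃ Φ : State Λ, Φ ∈ spinSpace Ne S ∧ Φ ≠ 0) :
    IsLeast (energies t U Ne S) (Emin t U Ne S) ∧
      ∃ Φ : State Λ, Φ ≠ 0 ∧ Φ ∈ spinSpace Ne S ∧
        hamiltonian t U *ᵥ Φ = (Emin t U Ne S : ℂ) • Φ := by
  obtain ⟨v, hv, hv1, hmin⟩ := exists_min_energy (hamiltonian t U) (spinSpace Ne S) hne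
  have hv' := mem_spinSpace.1 hv
  have hleast : IsLeast (energies t U Ne S) (star v ⬝ᵥ hamiltonian t U *ᵥ v).re := by
    refine ⟨⟨v, hv1, hv'.1, hv'.2, rfl⟩, ?_⟩
    rintro _ ⟨w, hw1, hwN, hwS, rfl⟩
    exact hmin w (mem_spinSpace.2 ⟨hwN, hwS⟩) hw1
  have hE : Emin t U Ne S = (star v ⬝ᵥ hamiltonian t U *ᵥ v).re := hleast.csInf_eq
  rw [hE]
  refine ⟨hleast, v, ?_, hv, ?_⟩
  · rintro rfl
    simp at hv1
  · exact mulVec_eq_smul_of_energy_le (hamiltonian_isHermitian ht _)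
      (fun w hw => mulVec_mem_spinSpace (hamiltonian_commute_spinHop t _) hw) hmin hv
      (by rw [hv1]; simp)

end Ground
end Hubbard

theorem mainTheorem10 {Λ : Type*} [Fintype Λ] [LinearOrder Λ]
    (t : Λ → Λ → ℝ) (U : ℝ) (A B : Finset Λ)
    (ht : ∀ x y, t x y = t y x)
    (hbip : Hubbard.IsBipartite t A B)
    (heven : Even (Fintype.card Λ))
    (hconn : Hubbard.IsConnected t)
    (hU : 0 < U)
    (S : ℕ)
    (hS : |(A.card : ℝ) - (B.card : ℝ)| / 2 ≤ (S : ℝ))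
    (hS' : (S : ℝ) ≤ (Fintype.card Λ : ℝ) / 2 - 1) :
    IsLeast (Hubbard.energies t (fun _ => U) (Fintype.card Λ) S)
        (Hubbard.Emin t (fun _ => U) (Fintype.card Λ) S) ∧
      IsLeast (Hubbard.energies t (fun _ => U) (Fintype.card Λ) (S + 1))
        (Hubbard.Emin t (fun _ => U) (Fintype.card Λ) (S + 1)) ∧
      Hubbard.Emin t (fun _ => U) (Fintype.card Λ) S
        < Hubbard.Emin t (fun _ => U) (Fintype.card Λ) (S + 1) := by
  obtain ⟨hdisj, hunion, htA, htB⟩ := hbip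
  obtain ⟨k, hk⟩ := heven
  have hcompl : Aᶜ = B :=
    compl_eq_iff_isCompl.2 ⟨hdisj, codisjoint_iff.2 hunion⟩
  have hcard : A.card + B.card = Fintype.card Λ := by
    rw [← hcompl]; exact Finset.card_add_card_compl A
  rw [hk] at hcard
  have hSk : S + 1 ≤ k := by
    rw [hk] at hS'
    push_cast at hS'
    have : (S : ℝ) + 1 ≤ k := by linarith
    exact_mod_cast this
  have hcardR : (A.card : ℝ) + B.card = k + k := by exact_mod_cast hcard
  have habs := abs_le.1 (show |(A.card : ℝ) - B.card| ≤ 2 * S by linarith)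
  have hA : A.card ≤ k + S := by
    have : (A.card : ℝ) ≤ k + S := by linarith [habs.2]
    exact_mod_cast this
  have hA' : Aᶜ.card ≤ k + S := by
    rw [hcompl]
    have : (B.card : ℝ) ≤ k + S := by linarith [habs.1]
    exact_mod_cast this
  have hsgn : ∀ x y, t x y ≠ 0 → Hubbard.sgn A x * Hubbard.sgn A y = -1 := by
    intro x y hxy
    unfold Hubbard.sgn
    by_cases hx : x ∈ A <;> by_cases hy : y ∈ A
    · exact absurd (htA x hx y hy) hxy
    · simp [hx, hy]
    · simp [hx, hy]
    · exact absurd (htB x (by simpa [← hcompl] using hx) y (by simpa [← hcompl] using hy)) hxy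
  -- States of spin `s` with `k + s` up electrons exist for every `s` from `S` to `k`.
  have href : ∀ s : ℕ, S ≤ s → s ≤ k →
      ∃ Φ : Hubbard.State Λ, Φ ∈ Hubbard.spinSpace (Fintype.card Λ) (s : ℝ) ∧ Φ ≠ 0 := by
    intro s hs hsk
    have hn : k + s ≤ Fintype.card Λ := by omega
    refine ⟨Hubbard.refState A (k + s), ?_, Hubbard.refState_ne_zero A hn⟩
    have hmem := Hubbard.mem_spinSpace_of_mem_sector (Hubbard.refState_mem_sector A hn)
      (S := s) (by
        rw [Nat.cast_sub hn, hk]; push_cast; ring)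
      (by rw [Hubbard.spinHop_up_down_mulVec_refState (by omega) (by omega)]; simp)
    rwa [Nat.add_sub_cancel' hn] at hmem
  have hne1 := href (S + 1) (by omega) hSk
  push_cast at hne1
  obtain ⟨hleast, -⟩ := Hubbard.exists_isLeast_energies ht (fun _ => U)
    (href S le_rfl (by omega))
  obtain ⟨hleast1, Φ, hΦ0, hΦS, hΦE⟩ := Hubbard.exists_isLeast_energies ht (fun _ => U) hne1
  refine ⟨hleast, hleast1, ?_⟩
  have hn : k + S ≤ Fintype.card Λ := by omega
  have hμ : ((k + S : ℕ) : ℝ) - ((Fintype.card Λ - (k + S) : ℕ) : ℝ) = 2 * S := by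
    rw [Nat.cast_sub hn, hk]; push_cast; ring
  have hH := Hubbard.hamiltonian_commute_spinHop t (fun _ => U)
  -- The lowest energy `E₀` of the sector with third spin component `S`.
  obtain ⟨v, hv, hv1, hmin⟩ := Hubbard.exists_min_energy (Hubbard.hamiltonian t fun _ => U)
    (Hubbard.sector (k + S) (Fintype.card Λ - (k + S)))
    ⟨_, Hubbard.refState_mem_sector A hn, Hubbard.refState_ne_zero A hn⟩
  set E₀ := (star v ⬝ᵥ Matrix.mulVec (Hubbard.hamiltonian t fun _ => U) v).re with hE₀
  have hspin : ∀ Ψ ∈ Hubbard.sector (k + S) (Fintype.card Λ - (k + S)),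
      Matrix.mulVec (Hubbard.hamiltonian t fun _ => U) Ψ = (E₀ : ℂ) • Ψ →
      Ψ ∈ Hubbard.spinSpace (Fintype.card Λ) (S : ℝ) := by
    intro Ψ hΨ hΨE
    have hmem := Hubbard.mem_spinSpace_of_mem_sector hΨ hμ
      (Hubbard.spinHop_mulVec_eq_zero_of_sector_ground ht hconn hsgn hU hn hA hA' hmin hΨ hΨE)
    rwa [Nat.add_sub_cancel' hn] at hmem
  have hvE := Hubbard.mulVec_eq_smul_of_energy_le (Hubbard.hamiltonian_isHermitian ht _)
    (fun w hw => Hubbard.mulVec_mem_sector hH hw) hmin hv (by rw [hv1]; simp [hE₀])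
  have hvS := Hubbard.mem_spinSpace.1 (hspin v hv hvE)
  have hle : Hubbard.Emin t (fun _ => U) (Fintype.card Λ) S ≤ E₀ :=
    hleast.2 ⟨v, hv1, hvS.1, hvS.2, rfl⟩
  -- A state of spin `S + 1` in the same sector, with the lowest energy for that spin.
  obtain ⟨Ψ, hΨ0, hΨS, hΨE, hΨn⟩ := Hubbard.exists_lowered_eigenstate hH (by positivity) hΦ0 hΦS
    hΦE
  set E₁ := Hubbard.Emin t (fun _ => U) (Fintype.card Λ) (S + 1) with hE₁
  rw [Hubbard.mem_spinSpace] at hΨS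
  have hΨ : Ψ ∈ Hubbard.sector (k + S) (Fintype.card Λ - (k + S)) := by
    have hup : Matrix.mulVec (Hubbard.spinHop 0 0) Ψ = ((k + S : ℕ) : ℂ) • Ψ := by
      rw [hΨn, hk]
      congr 1
      push_cast
      ring
    have h := hΨS.1
    rw [Hubbard.totalNum_eq, Matrix.add_mulVec, hup] at h
    rw [Hubbard.mem_sector]
    refine ⟨hup, ?_⟩
    rw [eq_sub_of_add_eq' h, Nat.cast_sub hn, sub_smul]
  have hpos := Hubbard.star_dotProduct_self_re_pos hΨ0
  have hle1 : E₀ ≤ E₁ := by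
    have h := Hubbard.mul_le_energy_of_unit hmin Ψ hΨ
    rw [hΨE, dotProduct_smul, smul_eq_mul, Complex.re_ofReal_mul] at h
    exact le_of_mul_le_mul_right h hpos
  refine hle.trans_lt (lt_of_le_of_ne hle1 fun heq => ?_)
  have hΨS' := (Hubbard.mem_spinSpace.1 (hspin Ψ hΨ (by rw [heq]; exact hΨE))).2
  rw [hΨS.2] at hΨS'
  have h := smul_left_injective ℂ hΨ0 hΨS'
  have h' : ((S : ℝ) + 1) * (S + 1 + 1) = S * (S + 1) := by exact_mod_cast h
  nlinarith [(Nat.cast_nonneg S : (0 : ℝ) ≤ S)]
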